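/- For a function $\omega$ on $\mathbb R^2$ that is bounded with compact support, let $$E[\omega]=\frac1{4\pi}\int_{\mathbb R^2}\int_{\mathbb R^2}\omega(x)\,\omega(x')\ln\frac1{|x-x'|}\,dx\,dx'.$$ For $0<r_1<r_2$ let $\bar\omega=\mathbf 1_{\{x\in\mathbb R^2:\,r_1\le|x|\le r_2\}}$. For an integer $m\ge 2$ let $\mathcal A^m$ be the set of all patches $\omega=\mathbf 1_A$, with $A\subset\mathbb R^2$ measurable, such that $$\int\omega\,dx=\int\bar\omega\,dx,\qquad \int|x|^2\omega\,dx=\int|x|^2\bar\omega\,dx,$$ and such that $\omega$ is $m$-fold symmetric, that is, invariant under the rotation about the origin by the angle $2\pi/m$. For $\varepsilon>0$ and $D\subset\mathbb R^2$ let $$\mathcal N_{\varepsilon,D}=\{\mathbf 1_A:\ A\subset D \text{ measurable},\ \|\mathbf 1_A-\bar\omega\|_{L^1(\mathbb R^2)}<\varepsilon\},$$ and let $B_\rho$ denote the open ball of radius $\rho$ centered at the origin. Then for any $0<r_1<r_2$ there exist an integer $m\ge2$ and constants $\bar r>1$, $\varepsilon_0>0$ and $c_0>0$ such that $$E[\bar\omega]-E[\omega]\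 \ge\ c_0\,\|\bar\omega-\omega\|_{L^1(\mathbb R^2)}^2$$ for every $0<\varepsilon<\varepsilon_0$ and every $\omega\in\mathcal A^m\cap\mathcal N_{\varepsilon,B_{\bar r r_2}}$. -/

import Mathlib

open MeasureTheory

noncomputable section

namespace EulerPatch

/-- The plane `ℝ²` with its Euclidean norm and Lebesgue measure. -/
abbrev Plane : Type := EuclideanSpace ℝ (Fin 2)

/-- Counterclockwise rotation of the plane about the origin by the angle `α`. -/
def rotation (α : ℝ) (x : Plane) : Plane :=
  !₂[Real.cos α * x 0 - Real.sin α * x 1, Real.sin α * x 0 + Real.cos α * x 1]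

/-- The stream function `G[ω](x) = (1 / 2π) ∫ ln (1 / |x - x'|) ω(x') dx'`. -/
def stream (ω : Plane → ℝ) (x : Plane) : ℝ :=
  1 / (2 * Real.pi) * ∫ x' : Plane, Real.log (1 / ‖x - x'‖) * ω x'

/-- The (pseudo-)energy `E[ω] = (1 / 2) ⟨ω, G[ω]⟩`, that is
`(1 / 4π) ∬ ω(x) ω(x') ln (1 / |x - x'|) dx dx'`. -/
def energy (ω : Plane → ℝ) : ℝ :=
  1 / 2 * ∫ x : Plane, ω x * stream ω x

/-- The characteristic function `1_A`. -/
def patch (A : Set Plane) : Plane → ℝ := A.indicator (fun _ => (1 : ℝ))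

/-- `ω = 1_A` for some Lebesgue measurable set `A ⊆ D`. -/
def IsPatchIn (D : Set Plane) (ω : Plane → ℝ) : Prop :=
  ∃ A : Set Plane, NullMeasurableSet A volume ∧ A ⊆ D ∧ ω = patch A

/-- The annular patch: the characteristic function of `{x : r₁ ≤ |x| ≤ r₂}`. -/
def annulus (r₁ r₂ : ℝ) : Plane → ℝ := patch {x : Plane | r₁ ≤ ‖x‖ ∧ ‖x‖ ≤ r₂}

/-- `ω` is `m`-fold symmetric: invariant under the rotation by `2π / m`. -/
def IsFoldSymmetric (m : ℕ) (ω : Plane → ℝ) : Prop :=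
  ∀ x : Plane, ω (rotation (2 * Real.pi / m) x) = ω x

/-- The admissible class: patches with the same mass and the same impulse as `ω₀`. -/
def admissible (ω₀ : Plane → ℝ) : Set (Plane → ℝ) :=
  {ω | IsPatchIn Set.univ ω ∧
    (∫ x : Plane, ω x) = (∫ x : Plane, ω₀ x) ∧
    (∫ x : Plane, ‖x‖ ^ 2 * ω x) = (∫ x : Plane, ‖x‖ ^ 2 * ω₀ x)}

/-- The admissible patches that are `m`-fold symmetric. -/
def admissibleFold (m : ℕ) (ω₀ : Plane → ℝ) : Set (Plane → ℝ) :=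
  admissible ω₀ ∩ {ω | IsFoldSymmetric m ω}

/-- The `L¹` distance `∫ |ω - ω'| dx` of two integrable functions. -/
def distL1 (ω ω' : Plane → ℝ) : ℝ := ∫ x : Plane, |ω x - ω' x|

/-- The patches in `D` whose `L¹` distance from `ω₀` is less than `ε`. -/
def neighborhood (ε : ℝ) (D : Set Plane) (ω₀ : Plane → ℝ) : Set (Plane → ℝ) :=
  {ω | IsPatchIn D ω ∧ distL1 ω ω₀ < ε}

end EulerPatch

end

/-!
The annular patch `ω̄` is a strict local maximizer of the energy among patches `ω` with the same
mass and impulse, provided that perturbations are `m`-fold symmetric with `m` large. With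
`σ = ω - ω̄` and the interaction `I(f, g) = ∬ f(x) g(y) log |x - y|`, the energy is `-I / (4π)`, so
`4π (E[ω̄] - E[ω]) = 2 I(ω̄, σ) + I(σ, σ)`. Everything is measured by the first moment
`D = ∫ d |σ|`, where `d(x)` is the distance from `x` to the two boundary circles (`radialGap`).

*Linear term.* The potential of `ω̄` is radial and explicit. As `σ` has no mass and no second
moment, the potential may be corrected by `a + b |x|²` so as to vanish on both circles. It is then negative
inside the annulus, where `σ ≤ 0`, and positive outside it up to a radius `R > r₂`, where `σ ≥ 0`,
with nonzero slope at the circles (`exists_ringPotential_gap`); hence `I(ω̄, σ) ≥ 2π c D`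
(`le_integral_mul_integral_annulusC`).

*Quadratic term.* By symmetry the kernel in `I(σ, σ)` may be replaced by its average over the `m`-th
roots of unity, `log |x ^ m - y ^ m| / m`. This equals `log max(|x|, |y|) + (log 2) / m` minus a
kernel `N` which is nonnegative and symmetric (`excessKernel`). By Newton's theorem
(`integral_radial_mul_log_norm_sub`), `N` integrates to `(log 2) / m` times the area over any radial
set. Splitting the double integral of `|σ| |σ| N` according to which of `x` and `y` is nearer to the
circles, and using that the strip `{d ≤ t}` has area `O(t)`, shows that `N` contributes `O(D / m)`
(`integral_prod_mul_excessKernel_le`). In the radial part `log max(|x|, |y|)` the kernel may be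
corrected by `α(x) + β(x) |y|²` so as to vanish for `y` on the circles. Its contribution is then at
most a constant times `D ∫ |σ| / |x|` (`abs_integral_prod_mul_log_max_le`), which is small relative
to `D` when `σ` is small in `L¹`.

For large `m` and small `σ` the linear term therefore dominates. Finally `D ≥ C⁻¹ ‖σ‖²` in `L¹`,
since `|σ| ≤ 1` and strips are thin (`sq_integral_abs_le_integral_mul_radialGap`).
-/

namespace EulerPatch

open Metric Set

/-! ### Integrability of the logarithmic kernels -/

lemma abs_log_le_inv_add_self {t : ℝ} (ht : 0 ≤ t) : |Real.log t| ≤ t⁻¹ + t := by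
  rcases ht.eq_or_lt with rfl | ht
  · simp
  have h1 := Real.log_le_sub_one_of_pos ht
  have h2 := Real.log_le_sub_one_of_pos (inv_pos.mpr ht)
  rw [Real.log_inv] at h2
  have := inv_pos.mpr ht
  rw [abs_le]
  constructor <;> linarith

lemma integrableOn_inv_norm_ball (R : ℝ) :
    IntegrableOn (fun x : ℂ => ‖x‖⁻¹) (ball 0 R) := by
  have h := integrableOn_fun_norm_addHaar (μ := (volume : Measure ℂ)) (f := fun t : ℝ => t⁻¹)
    (r := R)
  rw [h]
  have : IntegrableOn (fun _ : ℝ => (1 : ℝ)) (Ioo 0 R) := by simp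
  refine this.congr_fun (fun t ht => ?_) measurableSet_Ioo
  simp [ht.1.ne']

lemma integrableOn_log_norm_ball (R : ℝ) :
    IntegrableOn (fun x : ℂ => Real.log ‖x‖) (ball 0 R) := by
  have h2 : IntegrableOn (fun x : ℂ => ‖x‖) (ball 0 R) :=
    (continuous_norm.continuousOn.integrableOn_compact (isCompact_closedBall 0 R)).mono_set
      ball_subset_closedBall
  refine ((integrableOn_inv_norm_ball R).add h2).mono'
    (Real.measurable_log.comp measurable_norm).aestronglyMeasurable (ae_of_all _ fun x => ?_)
  exact abs_log_le_inv_add_self (norm_nonneg x)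

/-- Multiplication by a complex number of modulus one preserves the Lebesgue measure. -/
lemma measurePreserving_unit_mul {c : ℂ} (hc : ‖c‖ = 1) :
    MeasurePreserving (fun y : ℂ => c * y) := by
  have h := (_root_.rotation ⟨c, by simpa [Submonoid.unitSphere] using hc⟩).measurePreserving
  exact h

lemma measurableEmbedding_unit_mul {c : ℂ} (hc : ‖c‖ = 1) :
    MeasurableEmbedding (fun y : ℂ => c * y) :=
  (Homeomorph.mulLeft₀ c (norm_ne_zero_iff.mp (by simp [hc]))).measurableEmbedding

lemma integral_unit_mul {c : ℂ} (hc : ‖c‖ = 1) (f : ℂ → ℝ) :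
    ∫ y, f (c * y) = ∫ y, f y :=
  (measurePreserving_unit_mul hc).integral_comp (measurableEmbedding_unit_mul hc) f

lemma integrableOn_prod_log_norm_sub {c : ℂ} (hc : ‖c‖ = 1) (R : ℝ) :
    IntegrableOn (fun p : ℂ × ℂ => Real.log ‖p.1 - c * p.2‖) (ball 0 R ×ˢ ball 0 R) := by
  have hf : Integrable ((ball (0 : ℂ) R).indicator fun _ => (1 : ℝ)) :=
    (integrable_indicator_iff measurableSet_ball).mpr (integrableOn_const measure_ball_lt_top.ne)
  have hg : Integrable ((ball (0 : ℂ) (2 * R)).indicator fun x => Real.log ‖x‖) :=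
    (integrable_indicator_iff measurableSet_ball).mpr (integrableOn_log_norm_ball _)
  have h := hf.convolution_integrand (ContinuousLinearMap.mul ℝ ℝ) hg
  have hmp : MeasurePreserving (fun p : ℂ × ℂ => (p.1, c * p.2)) :=
    (MeasurePreserving.id volume).prod (measurePreserving_unit_mul hc)
  have h2 := hmp.integrable_comp_of_integrable h
  refine (h2.integrableOn (s := ball 0 R ×ˢ ball 0 R)).congr_fun (fun p hp => ?_)
    (measurableSet_ball.prod measurableSet_ball)
  obtain ⟨h3, h4⟩ := hp
  have h5 : ‖c * p.2‖ < R := by simpa [hc] using h4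
  have h6 : ‖p.1 - c * p.2‖ < 2 * R := by
    have := norm_sub_le p.1 (c * p.2)
    have : ‖p.1‖ < R := by simpa using h3
    linarith
  simp [indicator_of_mem, h6, hc, show ‖p.2‖ < R by simpa using h4]

lemma integrableOn_log_norm_sub (x : ℂ) (R : ℝ) :
    IntegrableOn (fun y : ℂ => Real.log ‖x - y‖) (ball 0 R) := by
  have h := (integrableOn_log_norm_ball (‖x‖ + R)).integrable_indicator measurableSet_ball
  have h2 := h.comp_sub_left x
  refine (h2.integrableOn (s := ball 0 R)).congr_fun (fun y hy => ?_) measurableSet_ball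
  have h6 : ‖x - y‖ < ‖x‖ + R := by
    have := norm_sub_le x y
    have : ‖y‖ < R := by simpa using hy
    linarith
  simp [h6]

lemma abs_log_max_le (a b : ℝ) : |Real.log (max a b)| ≤ |Real.log a| + |Real.log b| := by
  rcases max_choice a b with h | h <;> rw [h] <;> simp

lemma integrableOn_log_max (x : ℂ) (R : ℝ) :
    IntegrableOn (fun y : ℂ => Real.log (max ‖x‖ ‖y‖)) (ball 0 R) := by
  have : IsFiniteMeasure (volume.restrict (ball (0 : ℂ) R)) :=
    isFiniteMeasure_restrict.mpr measure_ball_lt_top.ne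
  refine ((integrable_const (|Real.log ‖x‖|)).add (integrableOn_log_norm_ball R).abs).mono'
    (Real.measurable_log.comp (by fun_prop)).aestronglyMeasurable
    (ae_of_all _ fun y => abs_log_max_le _ _)

lemma integrableOn_prod_log_max (R : ℝ) :
    IntegrableOn (fun p : ℂ × ℂ => Real.log (max ‖p.1‖ ‖p.2‖)) (ball 0 R ×ˢ ball 0 R) := by
  have : IsFiniteMeasure (volume.restrict (ball (0 : ℂ) R)) :=
    isFiniteMeasure_restrict.mpr measure_ball_lt_top.ne
  have h1 := (integrableOn_log_norm_ball R).abs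
  rw [IntegrableOn, Measure.volume_eq_prod, ← Measure.prod_restrict]
  refine ((h1.comp_fst _).add (h1.comp_snd _)).mono'
    (Real.measurable_log.comp (by fun_prop)).aestronglyMeasurable
    (ae_of_all _ fun p => abs_log_max_le _ _)

/-- Measurable functions with values in `[-1, 1]` that vanish outside the open ball of radius `R`
about the origin. -/
structure UnitBounded (R : ℝ) (f : ℂ → ℝ) : Prop where
  meas : AEStronglyMeasurable f
  abs_le : ∀ x, |f x| ≤ 1
  eq_zero : ∀ x, R ≤ ‖x‖ → f x = 0

lemma integrable_mul_of_integrableOn {α : Type*} [MeasurableSpace α] {μ : Measure α}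
    {S : Set α} (hS : MeasurableSet S) {k W : α → ℝ} (hk : IntegrableOn k S μ)
    (hW : AEStronglyMeasurable W μ) (h1 : ∀ p, |W p| ≤ 1) (h0 : ∀ p, p ∉ S → W p = 0) :
    Integrable (fun p => W p * k p) μ := by
  have := (hk.integrable_indicator hS).bdd_mul hW (ae_of_all _ h1)
  refine this.congr (ae_of_all _ fun p => ?_)
  by_cases hp : p ∈ S <;> simp [hp, h0]

namespace UnitBounded

variable {R : ℝ} {f g : ℂ → ℝ}

lemma abs (hf : UnitBounded R f) : UnitBounded R (fun x => |f x|) :=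
  ⟨hf.meas.norm, fun x => by simpa using hf.abs_le x, fun x hx => by simp [hf.eq_zero x hx]⟩

lemma integrable_mul (hf : UnitBounded R f) {k : ℂ → ℝ} (hk : IntegrableOn k (ball 0 R)) :
    Integrable (fun x => f x * k x) :=
  integrable_mul_of_integrableOn measurableSet_ball hk hf.meas hf.abs_le
    fun x hx => hf.eq_zero x (by simpa using hx)

lemma integrable_mul_continuous (hf : UnitBounded R f) {k : ℂ → ℝ} (hk : Continuous k) :
    Integrable (fun x => f x * k x) :=
  hf.integrable_mul ((hk.continuousOn.integrableOn_compact (isCompact_closedBall 0 R)).mono_set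
      ball_subset_closedBall)

lemma integrable (hf : UnitBounded R f) : Integrable f := by
  simpa using hf.integrable_mul_continuous (k := fun _ => 1) continuous_const

lemma integrable_prod_mul (hf : UnitBounded R f) (hg : UnitBounded R g) {k : ℂ × ℂ → ℝ}
    (hk : IntegrableOn k (ball 0 R ×ˢ ball 0 R)) :
    Integrable (fun p : ℂ × ℂ => f p.1 * g p.2 * k p) := by
  refine integrable_mul_of_integrableOn (measurableSet_ball.prod measurableSet_ball) hk
    (hf.meas.comp_fst.mul hg.meas.comp_snd) (fun p => ?_) (fun p hp => ?_)
  · rw [abs_mul]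
    exact mul_le_one₀ (hf.abs_le _) (abs_nonneg _) (hg.abs_le _)
  · rw [mem_prod, not_and_or] at hp
    rcases hp with hp | hp
    · simp [hf.eq_zero p.1 (by simpa using hp)]
    · simp [hg.eq_zero p.2 (by simpa using hp)]

end UnitBounded

/-! ### Newton's theorem in the plane -/

/-- The logarithm of the distance to `x`, averaged over the circle through `y`. -/
lemma intervalIntegral_log_norm_sub_circle (x y : ℂ) :
    ∫ θ in (0)..2 * Real.pi, Real.log ‖x - circleMap 0 1 θ * y‖ =
      2 * Real.pi * Real.log (max ‖x‖ ‖y‖) := by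
  by_cases hy : y = 0
  · simp [hy]
  have hy' : ‖y‖ ≠ 0 := by simpa using hy
  have hyC : (‖y‖ : ℂ) ≠ 0 := by exact_mod_cast hy'
  -- rotate `x` instead of `y`, so that the integrand lives on a circle of real radius
  set u : ℂ := ‖y‖ / y with hu
  have hun : ‖u‖ = 1 := by simp [hu, hy']
  have key : ∀ θ, ‖x - circleMap 0 1 θ * y‖ = ‖circleMap 0 ‖y‖ θ - u * x‖ := by
    intro θ
    have : circleMap 0 ‖y‖ θ - u * x = -u * (x - circleMap 0 1 θ * y) := by
      simp only [circleMap, hu]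
      field_simp
      push_cast
      ring
    rw [this, norm_mul, norm_neg, hun, one_mul]
  have h := circleAverage_log_norm_sub_const_eq_log_radius_add_posLog (a := u * x) (c := 0) hy'
  rw [Real.circleAverage, smul_eq_mul] at h
  simp_rw [key]
  have hpi := Real.pi_pos
  rw [inv_mul_eq_iff_eq_mul₀ (by positivity)] at h
  rw [h, zero_sub, norm_neg, norm_mul, hun, one_mul]
  congr 1
  have hyp : 0 < ‖y‖ := norm_pos_iff.mpr hy
  rcases le_total ‖x‖ ‖y‖ with hxy | hxy
  · rw [max_eq_right hxy, (Real.posLog_eq_zero_iff _).mpr, add_zero]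
    rw [abs_of_nonneg (by positivity), inv_mul_le_one₀ hyp]
    exact hxy
  · rw [max_eq_left hxy, Real.posLog_eq_log, Real.log_mul (by positivity) (by linarith),
      Real.log_inv]
    · ring
    · rw [abs_of_nonneg (by positivity), le_inv_mul_iff₀ hyp]
      linarith

/-- Newton's theorem: a radial density generates the same potential as if every circle carried
its mass uniformly, so that the kernel `log ‖x - y‖` may be replaced by its circular mean. -/
lemma integral_radial_mul_log_norm_sub {R : ℝ} {h : ℂ → ℝ} (hh : UnitBounded R h)
    (hrad : ∀ c y : ℂ, ‖c‖ = 1 → h (c * y) = h y) (x : ℂ) :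
    ∫ y, h y * Real.log ‖x - y‖ = ∫ y, h y * Real.log (max ‖x‖ ‖y‖) := by
  have hcirc : ∀ θ, ‖circleMap 0 1 θ‖ = 1 := fun θ => by simp
  have hrot : ∀ θ, (fun y => h y * Real.log ‖x - circleMap 0 1 θ * y‖) =
      (fun y => (fun z => h z * Real.log ‖x - z‖) (circleMap 0 1 θ * y)) := by
    intro θ; ext y; simp [hrad _ y (hcirc θ)]
  have hint0 : Integrable fun z => h z * Real.log ‖x - z‖ :=
    hh.integrable_mul (integrableOn_log_norm_sub x R)
  have hint : Integrable (Function.uncurry fun (θ : ℝ) y =>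
      h y * Real.log ‖x - circleMap 0 1 θ * y‖)
      ((volume.restrict (Ioc 0 (2 * Real.pi))).prod volume) := by
    have hm : AEStronglyMeasurable (Function.uncurry fun (θ : ℝ) y =>
      h y * Real.log ‖x - circleMap 0 1 θ * y‖)
      ((volume.restrict (Ioc 0 (2 * Real.pi))).prod volume) := by
      refine AEStronglyMeasurable.mul hh.meas.comp_snd ?_
      have : Continuous fun p : ℝ × ℂ => x - circleMap 0 1 p.1 * p.2 := by fun_prop
      exact (Real.measurable_log.comp this.norm.measurable).aestronglyMeasurable
    rw [integrable_prod_iff hm]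
    constructor
    · refine ae_of_all _ fun θ => ?_
      simp only [Function.uncurry_apply_pair]
      rw [hrot θ]
      exact (measurePreserving_unit_mul (hcirc θ)).integrable_comp_of_integrable hint0
    · simp only [Function.uncurry_apply_pair]
      have : ∀ θ, ∫ y, ‖h y * Real.log ‖x - circleMap 0 1 θ * y‖‖ =
          ∫ y, ‖h y * Real.log ‖x - y‖‖ := by
        intro θ
        rw [← integral_unit_mul (hcirc θ) (fun y => ‖h y * Real.log ‖x - y‖‖)]
        simp_rw [hrad _ _ (hcirc θ)]
      simp_rw [this]
      exact integrable_const _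
  have hswap := integral_integral_swap hint
  have h1 : ∀ θ, ∫ y, h y * Real.log ‖x - circleMap 0 1 θ * y‖ = ∫ y, h y * Real.log ‖x - y‖ := by
    intro θ
    rw [hrot θ, integral_unit_mul (hcirc θ) (fun z => h z * Real.log ‖x - z‖)]
  have hpi := Real.pi_pos
  simp_rw [h1, integral_const_mul] at hswap
  simp_rw [← intervalIntegral.integral_of_le (show (0 : ℝ) ≤ 2 * Real.pi by positivity),
    intervalIntegral_log_norm_sub_circle] at hswap
  rw [intervalIntegral.integral_const, smul_eq_mul] at hswap
  have : ∀ y, h y * (2 * Real.pi * Real.log (max ‖x‖ ‖y‖)) =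
      2 * Real.pi * (h y * Real.log (max ‖x‖ ‖y‖)) := fun y => by ring
  simp_rw [this, integral_const_mul, sub_zero] at hswap
  exact mul_left_cancel₀ (by positivity) hswap

/-! ### Radial strips around the two boundary circles -/

/-- The distance from `x` to the union of the circles of radii `r₁` and `r₂` about the origin. -/
noncomputable def radialGap (r₁ r₂ : ℝ) (x : ℂ) : ℝ := min |‖x‖ - r₁| |‖x‖ - r₂|

/-- The indicator function of the points of the ball of radius `R` whose distance to the two
boundary circles is at most `t`. -/
noncomputable def strip (r₁ r₂ R t : ℝ) : ℂ → ℝ :=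
  {y : ℂ | ‖y‖ < R ∧ radialGap r₁ r₂ y ≤ t}.indicator fun _ => 1

section

variable {r₁ r₂ R t : ℝ}

lemma radialGap_nonneg (x : ℂ) : 0 ≤ radialGap r₁ r₂ x :=
  le_min (abs_nonneg _) (abs_nonneg _)

lemma continuous_radialGap : Continuous (radialGap r₁ r₂) := by
  unfold radialGap
  fun_prop

lemma measurableSet_strip (r₁ r₂ R t : ℝ) :
    MeasurableSet {y : ℂ | ‖y‖ < R ∧ radialGap r₁ r₂ y ≤ t} :=
  (measurableSet_lt measurable_norm measurable_const).inter
    (measurableSet_le continuous_radialGap.measurable measurable_const)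

lemma unitBounded_indicator {S : Set ℂ} (hS : NullMeasurableSet S) (hR : ∀ x ∈ S, ‖x‖ < R) :
    UnitBounded R (S.indicator fun _ => (1 : ℝ)) where
  meas := (aestronglyMeasurable_indicator_iff₀ hS).mpr aestronglyMeasurable_const
  abs_le x := by by_cases h : x ∈ S <;> simp [h]
  eq_zero x hx := indicator_of_notMem (fun h => absurd (hR x h) hx.not_gt) _

lemma unitBounded_strip : UnitBounded R (strip r₁ r₂ R t) :=
  unitBounded_indicator (measurableSet_strip r₁ r₂ R t).nullMeasurableSet fun _ h => h.1

lemma strip_unit_mul (c y : ℂ) (hc : ‖c‖ = 1) :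
    strip r₁ r₂ R t (c * y) = strip r₁ r₂ R t y := by
  simp [strip, indicator, radialGap, hc]

lemma strip_nonneg (y : ℂ) : 0 ≤ strip r₁ r₂ R t y :=
  indicator_nonneg (fun _ _ => zero_le_one) _

lemma strip_eq_one {y : ℂ} (hy : ‖y‖ < R) (ht : radialGap r₁ r₂ y ≤ t) :
    strip r₁ r₂ R t y = 1 := by
  simp [strip, hy, ht]

lemma integral_complex_radial (f : ℝ → ℝ) :
    ∫ x : ℂ, f ‖x‖ = 2 * Real.pi * ∫ s in Ioi (0 : ℝ), s * f s := by
  rw [integral_fun_norm_addHaar]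
  simp [Measure.real, mul_assoc]

/-- The area of a strip grows at most linearly with its width. -/
lemma integral_strip_le (hR : 0 < R) (ht : 0 ≤ t) :
    ∫ y, strip r₁ r₂ R t y ≤ 8 * Real.pi * R * t := by
  set T : Set ℝ := {s | s < R ∧ min |s - r₁| |s - r₂| ≤ t}
  set U : Set ℝ := Icc (r₁ - t) (r₁ + t) ∪ Icc (r₂ - t) (r₂ + t)
  have h1 : ∫ y, strip r₁ r₂ R t y =
      2 * Real.pi * ∫ s in Ioi (0 : ℝ), s * T.indicator (fun _ => 1) s := by
    rw [← integral_complex_radial]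
    rfl
  have hU : MeasurableSet U := measurableSet_Icc.union measurableSet_Icc
  have hUfin : volume U ≠ ⊤ := by
    refine (measure_union_lt_top ?_ ?_).ne <;> simp
  have hUi : Integrable (U.indicator fun _ => R) :=
    (integrable_indicator_iff hU).mpr (integrableOn_const hUfin)
  have h2 : ∫ s in Ioi (0 : ℝ), s * T.indicator (fun _ => 1) s ≤
      ∫ s in Ioi (0 : ℝ), U.indicator (fun _ => R) s := by
    refine integral_mono_of_nonneg ?_ hUi.integrableOn ?_
    · filter_upwards [ae_restrict_mem measurableSet_Ioi] with s hs
      exact mul_nonneg (le_of_lt hs) (indicator_nonneg (fun _ _ => zero_le_one) _)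
    · filter_upwards [ae_restrict_mem measurableSet_Ioi] with s hs
      by_cases h : s ∈ T
      · have hsU : s ∈ U := by
          rcases min_le_iff.mp h.2 with h' | h' <;> rw [abs_le] at h'
          · left; constructor <;> linarith
          · right; constructor <;> linarith
        simpa [h, hsU] using h.1.le
      · simp only [h, not_false_eq_true, indicator_of_notMem, mul_zero]
        exact indicator_nonneg (fun _ _ => hR.le) _
  have h3 : ∫ s in Ioi (0 : ℝ), U.indicator (fun _ => R) s ≤ ∫ s, U.indicator (fun _ => R) s :=
    setIntegral_le_integral hUi (ae_of_all _ fun s => indicator_nonneg (fun _ _ => hR.le) _)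
  have h4 : ∫ s, U.indicator (fun _ => R) s ≤ 4 * t * R := by
    rw [integral_indicator hU, setIntegral_const, smul_eq_mul]
    refine mul_le_mul_of_nonneg_right ?_ hR.le
    refine (measureReal_union_le _ _).trans ?_
    simp only [Real.volume_real_Icc]
    rw [max_eq_left (by linarith), max_eq_left (by linarith)]
    linarith
  rw [h1]
  have hpi := Real.pi_pos
  calc _ ≤ 2 * Real.pi * (4 * t * R) := by
        gcongr
        linarith
    _ = _ := by ring

lemma UnitBounded.integrable_mul_radialGap {f : ℂ → ℝ} (hf : UnitBounded R f) :
    Integrable fun x => f x * radialGap r₁ r₂ x :=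
  hf.integrable_mul_continuous continuous_radialGap

/-- Since at most an area of order `t` lies within distance `t` of the two circles, a density
bounded by one cannot concentrate there: its first moment dominates its squared mass. -/
lemma sq_integral_abs_le_integral_mul_radialGap {f : ℂ → ℝ} (hR : 0 < R)
    (hf : UnitBounded R f) :
    (∫ x, |f x|) ^ 2 ≤ 32 * Real.pi * R * ∫ x, |f x| * radialGap r₁ r₂ x := by
  have hpi := Real.pi_pos
  set M := ∫ x, |f x|
  have hM : 0 ≤ M := integral_nonneg fun _ => abs_nonneg _
  -- this width makes the strip carry at most half of the mass
  set t := M / (16 * Real.pi * R) with ht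
  have ht0 : 0 ≤ t := by positivity
  have h1 : ∫ x, (t * |f x| - t * strip r₁ r₂ R t x) ≤ ∫ x, |f x| * radialGap r₁ r₂ x := by
    refine integral_mono ((hf.abs.integrable.const_mul t).sub
      (unitBounded_strip.integrable.const_mul t)) hf.abs.integrable_mul_radialGap fun x => ?_
    dsimp only
    have hfx := abs_nonneg (f x)
    by_cases hx : ‖x‖ < R
    · by_cases hg : radialGap r₁ r₂ x ≤ t
      · have : strip r₁ r₂ R t x = 1 := strip_eq_one hx hg
        rw [this]
        have := mul_nonneg hfx (radialGap_nonneg (r₁ := r₁) (r₂ := r₂) x)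
        nlinarith [hf.abs_le x]
      · have : strip r₁ r₂ R t x = 0 := indicator_of_notMem (fun h => hg h.2) _
        rw [this]
        nlinarith [mul_le_mul_of_nonneg_left (not_le.mp hg).le hfx]
    · have : strip r₁ r₂ R t x = 0 := indicator_of_notMem (fun h => hx h.1) _
      simp [this, hf.eq_zero x (not_lt.mp hx)]
  rw [integral_sub (hf.abs.integrable.const_mul t) (unitBounded_strip.integrable.const_mul t),
    integral_const_mul, integral_const_mul] at h1
  have h2 := mul_le_mul_of_nonneg_left (integral_strip_le (r₁ := r₁) (r₂ := r₂) hR ht0) ht0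
  have h3 : M = 16 * Real.pi * R * t := by rw [ht]; field_simp
  have h4 : t * M - t * (8 * Real.pi * R * t) ≤ ∫ x, |f x| * radialGap r₁ r₂ x := by linarith
  calc M ^ 2 = 32 * Real.pi * R * (t * M - t * (8 * Real.pi * R * t)) := by rw [h3]; ring
    _ ≤ _ := by gcongr

/-! ### The non-radial part of the kernel -/

lemma ae_pow_ne {m : ℕ} (hm : 0 < m) (x : ℂ) : ∀ᵐ y : ℂ, x ^ m ≠ y ^ m := by
  have : {y : ℂ | ¬ x ^ m ≠ y ^ m} ⊆ (Polynomial.nthRoots m (x ^ m)).toFinset := by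
    intro y hy
    simpa [Polynomial.mem_nthRoots hm, eq_comm] using hy
  exact measure_mono_null this ((Finset.finite_toSet _).measure_zero _)

lemma ae_prod_pow_ne {m : ℕ} (hm : 0 < m) : ∀ᵐ p : ℂ × ℂ, p.1 ^ m ≠ p.2 ^ m := by
  rw [Measure.volume_eq_prod]
  have hS : MeasurableSet {p : ℂ × ℂ | p.1 ^ m ≠ p.2 ^ m} :=
    (measurableSet_eq_fun (by fun_prop) (by fun_prop)).compl
  exact (Measure.ae_prod_iff_ae_ae hS).mpr (ae_of_all _ fun x => ae_pow_ne hm x)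

lemma log_norm_pow_sub_pow {m : ℕ} (hm : 0 < m) {x y : ℂ} (h : x ^ m ≠ y ^ m) :
    Real.log ‖x ^ m - y ^ m‖ =
      ∑ c ∈ Polynomial.nthRootsFinset m (1 : ℂ), Real.log ‖x - c * y‖ := by
  have hprod := (Complex.isPrimitiveRoot_exp m hm.ne').pow_sub_pow_eq_prod_sub_mul (x := x)
    (y := y) hm
  have hne : ∏ c ∈ Polynomial.nthRootsFinset m (1 : ℂ), (x - c * y) ≠ 0 := by
    rw [← hprod]
    exact sub_ne_zero.mpr h
  rw [hprod, norm_prod, Real.log_prod]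
  intro c hc
  exact norm_ne_zero_iff.mpr (Finset.prod_ne_zero_iff.mp hne c hc)

lemma norm_eq_one_of_mem_nthRootsFinset {m : ℕ} (hm : 0 < m) {c : ℂ}
    (hc : c ∈ Polynomial.nthRootsFinset m (1 : ℂ)) : ‖c‖ = 1 :=
  Complex.norm_eq_one_of_pow_eq_one ((Polynomial.mem_nthRootsFinset hm _).mp hc) hm.ne'

lemma card_nthRootsFinset_complex {m : ℕ} (hm : 0 < m) :
    (Polynomial.nthRootsFinset m (1 : ℂ)).card = m :=
  (Complex.isPrimitiveRoot_exp m hm.ne').card_nthRootsFinset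

lemma integrableOn_prod_log_norm_pow_sub_pow {m : ℕ} (hm : 0 < m) :
    IntegrableOn (fun p : ℂ × ℂ => Real.log ‖p.1 ^ m - p.2 ^ m‖) (ball 0 R ×ˢ ball 0 R) := by
  have h : IntegrableOn (fun p : ℂ × ℂ => ∑ c ∈ Polynomial.nthRootsFinset m (1 : ℂ),
      Real.log ‖p.1 - c * p.2‖) (ball 0 R ×ˢ ball 0 R) :=
    integrable_finsetSum _ fun c hc =>
      integrableOn_prod_log_norm_sub (norm_eq_one_of_mem_nthRootsFinset hm hc) R
  refine h.congr (ae_restrict_of_ae ?_)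
  filter_upwards [ae_prod_pow_ne hm] with p hp
  rw [log_norm_pow_sub_pow hm hp]

/-- For densities with `m`-fold symmetry the kernel `log ‖x - y‖` may be averaged over the
`m`-th roots of unity, which turns it into `log ‖x ^ m - y ^ m‖ / m`. -/
lemma integral_prod_mul_log_norm_sub_eq {m : ℕ} (hm : 0 < m) {f : ℂ → ℝ}
    (hf : UnitBounded R f) (hsymm : ∀ c x : ℂ, c ^ m = 1 → f (c * x) = f x) :
    m * ∫ p : ℂ × ℂ, f p.1 * f p.2 * Real.log ‖p.1 - p.2‖ =
      ∫ p : ℂ × ℂ, f p.1 * f p.2 * Real.log ‖p.1 ^ m - p.2 ^ m‖ := by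
  have h1 : ∫ p : ℂ × ℂ, f p.1 * f p.2 * Real.log ‖p.1 ^ m - p.2 ^ m‖ =
      ∫ p : ℂ × ℂ, ∑ c ∈ Polynomial.nthRootsFinset m (1 : ℂ),
        f p.1 * f p.2 * Real.log ‖p.1 - c * p.2‖ := by
    refine integral_congr_ae ?_
    filter_upwards [ae_prod_pow_ne hm] with p hp
    rw [log_norm_pow_sub_pow hm hp, Finset.mul_sum]
  have h2 : ∀ c ∈ Polynomial.nthRootsFinset m (1 : ℂ),
      ∫ p : ℂ × ℂ, f p.1 * f p.2 * Real.log ‖p.1 - c * p.2‖ =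
        ∫ p : ℂ × ℂ, f p.1 * f p.2 * Real.log ‖p.1 - p.2‖ := by
    intro c hc
    have hc1 := norm_eq_one_of_mem_nthRootsFinset hm hc
    have hmp : MeasurePreserving (fun p : ℂ × ℂ => (p.1, c * p.2)) :=
      (MeasurePreserving.id volume).prod (measurePreserving_unit_mul hc1)
    have hemb : MeasurableEmbedding (fun p : ℂ × ℂ => (p.1, c * p.2)) :=
      MeasurableEmbedding.id.prodMap (measurableEmbedding_unit_mul hc1)
    rw [← hmp.integral_comp hemb fun p : ℂ × ℂ => f p.1 * f p.2 * Real.log ‖p.1 - p.2‖]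
    simp only [hsymm c _ ((Polynomial.mem_nthRootsFinset hm _).mp hc)]
  rw [h1, integral_finsetSum, Finset.sum_congr rfl h2, Finset.sum_const,
    card_nthRootsFinset_complex hm, nsmul_eq_mul]
  exact fun c hc => hf.integrable_prod_mul hf
    (integrableOn_prod_log_norm_sub (norm_eq_one_of_mem_nthRootsFinset hm hc) R)

/-- The excess of the radial kernel over the averaged kernel, shifted by `log 2 / m` so that it is
nonnegative off a null set. -/
noncomputable def excessKernel (m : ℕ) (p : ℂ × ℂ) : ℝ :=
  Real.log (max ‖p.1‖ ‖p.2‖) + Real.log 2 / m - Real.log ‖p.1 ^ m - p.2 ^ m‖ / m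

lemma excessKernel_nonneg {m : ℕ} (hm : 0 < m) {p : ℂ × ℂ} (hp : p.1 ^ m ≠ p.2 ^ m) :
    0 ≤ excessKernel m p := by
  have hm' : (0 : ℝ) < m := by exact_mod_cast hm
  set M := max ‖p.1‖ ‖p.2‖
  have h0 : 0 < ‖p.1 ^ m - p.2 ^ m‖ := norm_pos_iff.mpr (sub_ne_zero.mpr hp)
  have h1 : ‖p.1 ^ m - p.2 ^ m‖ ≤ 2 * M ^ m := by
    refine (norm_sub_le _ _).trans ?_
    rw [norm_pow, norm_pow, two_mul]
    gcongr
    exacts [le_max_left _ _, le_max_right _ _]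
  have hM : M ^ m ≠ 0 := by
    intro h
    rw [h] at h1
    linarith
  have h2 := Real.log_le_log h0 h1
  rw [Real.log_mul two_ne_zero hM, Real.log_pow] at h2
  have : excessKernel m p =
      (Real.log 2 + m * Real.log M - Real.log ‖p.1 ^ m - p.2 ^ m‖) / m := by
    rw [excessKernel]
    field_simp
    ring
  rw [this]
  exact div_nonneg (by linarith) hm'.le

lemma excessKernel_swap (m : ℕ) (p : ℂ × ℂ) : excessKernel m p.swap = excessKernel m p := by
  simp [excessKernel, max_comm, norm_sub_rev]

lemma integrableOn_excessKernel {m : ℕ} (hm : 0 < m) :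
    IntegrableOn (excessKernel m) (ball 0 R ×ˢ ball 0 R) := by
  have hfin : volume (ball (0 : ℂ) R ×ˢ ball (0 : ℂ) R) ≠ ⊤ := by
    rw [Measure.volume_eq_prod, Measure.prod_prod]
    exact ENNReal.mul_ne_top measure_ball_lt_top.ne measure_ball_lt_top.ne
  exact ((integrableOn_prod_log_max R).add (integrableOn_const hfin)).sub
    ((integrableOn_prod_log_norm_pow_sub_pow hm).div_const _)

/-- By Newton's theorem, the averaged kernel and the radial kernel have the same integral against
a radial density, so that only the shift of the excess kernel contributes. -/
lemma integral_radial_mul_excessKernel {m : ℕ} (hm : 0 < m) {h : ℂ → ℝ} (hh : UnitBounded R h)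
    (hrad : ∀ c y : ℂ, ‖c‖ = 1 → h (c * y) = h y) (x : ℂ) :
    ∫ y, h y * excessKernel m (x, y) = Real.log 2 / m * ∫ y, h y := by
  have hm' : (m : ℝ) ≠ 0 := by exact_mod_cast hm.ne'
  have hrot : ∀ c : ℂ, ‖c‖ = 1 → (fun y => h y * Real.log ‖x - c * y‖) =
      fun y => (fun z => h z * Real.log ‖x - z‖) (c * y) := by
    intro c hc
    ext y
    simp only [hrad c y hc]
  have h0 : Integrable fun z => h z * Real.log ‖x - z‖ :=
    hh.integrable_mul (integrableOn_log_norm_sub x R)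
  have hc_int : ∀ c ∈ Polynomial.nthRootsFinset m (1 : ℂ),
      Integrable fun y => h y * Real.log ‖x - c * y‖ := by
    intro c hc
    have hc1 := norm_eq_one_of_mem_nthRootsFinset hm hc
    rw [hrot c hc1]
    exact (measurePreserving_unit_mul hc1).integrable_comp_of_integrable h0
  have hae : (fun y => ∑ c ∈ Polynomial.nthRootsFinset m (1 : ℂ), h y * Real.log ‖x - c * y‖)
      =ᵐ[volume] fun y => h y * Real.log ‖x ^ m - y ^ m‖ := by
    filter_upwards [ae_pow_ne hm x] with y hy
    rw [log_norm_pow_sub_pow hm hy, Finset.mul_sum]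
  have hI : Integrable fun y => h y * Real.log ‖x ^ m - y ^ m‖ :=
    (integrable_finsetSum _ hc_int).congr hae
  have h1 : ∫ y, h y * Real.log ‖x ^ m - y ^ m‖ =
      m * ∫ y, h y * Real.log (max ‖x‖ ‖y‖) := by
    rw [← integral_congr_ae hae, integral_finsetSum _ hc_int,
      Finset.sum_congr rfl fun c hc => ?_, Finset.sum_const, card_nthRootsFinset_complex hm,
      nsmul_eq_mul]
    have hc1 := norm_eq_one_of_mem_nthRootsFinset hm hc
    rw [hrot c hc1, integral_unit_mul hc1 (fun z => h z * Real.log ‖x - z‖),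
      integral_radial_mul_log_norm_sub hh hrad x]
  have h2 : ∀ y, h y * excessKernel m (x, y) = h y * Real.log (max ‖x‖ ‖y‖) +
      Real.log 2 / m * h y - (m : ℝ)⁻¹ * (h y * Real.log ‖x ^ m - y ^ m‖) := by
    intro y
    rw [excessKernel]
    ring
  have hmax : Integrable fun y => h y * Real.log (max ‖x‖ ‖y‖) :=
    hh.integrable_mul (integrableOn_log_max x R)
  simp_rw [h2]
  have hadd : Integrable fun y => h y * Real.log (max ‖x‖ ‖y‖) + Real.log 2 / m * h y :=
    hmax.add (hh.integrable.const_mul _)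
  rw [integral_sub hadd (hI.const_mul _),
    integral_add hmax (hh.integrable.const_mul _), integral_const_mul, integral_const_mul, h1]
  field_simp
  ring

/-- The excess kernel contributes at most `O(1 / m)` times the first moment of `|f|`. Of any two
points, the one nearer to the boundary circles is confined to a strip whose width is the gap of
the other one, and over such a strip the excess kernel integrates to `log 2 / m` times the area. -/
lemma integral_prod_mul_excessKernel_le {m : ℕ} (hm : 0 < m) (hR : 0 < R) {f : ℂ → ℝ}
    (hf : UnitBounded R f) :
    ∫ p : ℂ × ℂ, f p.1 * f p.2 * excessKernel m p ≤
      16 * Real.pi * R * Real.log 2 / m * ∫ x, |f x| * radialGap r₁ r₂ x := by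
  set d := radialGap r₁ r₂
  have hm' : (0 : ℝ) < m := by exact_mod_cast hm
  set G : ℂ × ℂ → ℝ := fun p => |f p.1| * strip r₁ r₂ R (d p.1) p.2 * excessKernel m p
  have hstripm : Measurable fun p : ℂ × ℂ => strip r₁ r₂ R (d p.1) p.2 := by
    have hS : MeasurableSet {p : ℂ × ℂ | ‖p.2‖ < R ∧ d p.2 ≤ d p.1} :=
      (measurableSet_lt measurable_snd.norm measurable_const).inter
        (measurableSet_le (continuous_radialGap.measurable.comp measurable_snd)
          (continuous_radialGap.measurable.comp measurable_fst))
    exact (measurable_const (a := (1 : ℝ))).indicator hS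
  have hG : Integrable G := by
    refine integrable_mul_of_integrableOn (measurableSet_ball.prod measurableSet_ball)
      (integrableOn_excessKernel (R := R) hm)
      (hf.abs.meas.comp_fst.mul hstripm.aestronglyMeasurable) (fun p => ?_) (fun p hp => ?_)
    · rw [abs_mul]
      exact mul_le_one₀ (hf.abs.abs_le _) (abs_nonneg _) (unitBounded_strip.abs_le _)
    · rw [mem_prod, not_and_or] at hp
      rcases hp with hp | hp
      · simp [hf.eq_zero p.1 (by simpa using hp)]
      · simp [unitBounded_strip.eq_zero p.2 (by simpa using hp)]
  have hGs : Integrable fun p : ℂ × ℂ => G p.swap := hG.swap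
  have hGint : ∫ p, G p ≤ Real.log 2 / m * (8 * Real.pi * R) * ∫ x, |f x| * d x := by
    rw [Measure.volume_eq_prod, integral_prod _ hG, ← integral_const_mul]
    refine integral_mono hG.integral_prod_left
      (hf.abs.integrable_mul_radialGap.const_mul _) fun x => ?_
    simp only [G, mul_assoc]
    rw [integral_const_mul, integral_radial_mul_excessKernel hm unitBounded_strip
      (fun c y hc => strip_unit_mul c y hc)]
    have := integral_strip_le (r₁ := r₁) (r₂ := r₂) hR (radialGap_nonneg (r₁ := r₁) (r₂ := r₂) x)
    calc |f x| * (Real.log 2 / m * ∫ y, strip r₁ r₂ R (d x) y)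
        ≤ |f x| * (Real.log 2 / m * (8 * Real.pi * R * d x)) := by
          gcongr
      _ = _ := by ring
  have hle : ∫ p : ℂ × ℂ, f p.1 * f p.2 * excessKernel m p ≤ ∫ p, (G p + G p.swap) := by
    refine integral_mono_ae (hf.integrable_prod_mul hf (integrableOn_excessKernel hm))
      (hG.add hGs) ?_
    filter_upwards [ae_prod_pow_ne hm] with p hp
    have hN := excessKernel_nonneg hm hp
    have hb : f p.1 * f p.2 ≤
        |f p.1| * strip r₁ r₂ R (d p.1) p.2 + |f p.2| * strip r₁ r₂ R (d p.2) p.1 := by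
      have e1 : f p.1 * f p.2 ≤ |f p.1| * |f p.2| := by
        rw [← abs_mul]
        exact le_abs_self _
      have n1 := mul_nonneg (abs_nonneg (f p.1))
        (strip_nonneg (r₁ := r₁) (r₂ := r₂) (R := R) (t := d p.1) p.2)
      have n2 := mul_nonneg (abs_nonneg (f p.2))
        (strip_nonneg (r₁ := r₁) (r₂ := r₂) (R := R) (t := d p.2) p.1)
      by_cases h1 : ‖p.1‖ < R
      · by_cases h2 : ‖p.2‖ < R
        · rcases le_total (d p.2) (d p.1) with h | h
          · have : strip r₁ r₂ R (d p.1) p.2 = 1 := strip_eq_one h2 h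
            rw [this] at n1 ⊢
            nlinarith [mul_le_mul_of_nonneg_left (hf.abs_le p.2) (abs_nonneg (f p.1))]
          · have : strip r₁ r₂ R (d p.2) p.1 = 1 := strip_eq_one h1 h
            rw [this] at n2 ⊢
            nlinarith [mul_le_mul_of_nonneg_right (hf.abs_le p.1) (abs_nonneg (f p.2))]
        · rw [hf.eq_zero p.2 (not_lt.mp h2), mul_zero]
          rw [hf.eq_zero p.2 (not_lt.mp h2)] at n2
          linarith
      · rw [hf.eq_zero p.1 (not_lt.mp h1), zero_mul]
        rw [hf.eq_zero p.1 (not_lt.mp h1)] at n1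
        linarith
    have hs : G p.swap = |f p.2| * strip r₁ r₂ R (d p.2) p.1 * excessKernel m p := by
      simp only [G, excessKernel_swap, Prod.fst_swap, Prod.snd_swap]
    rw [hs, ← add_mul]
    exact mul_le_mul_of_nonneg_right hb hN
  have hsw : ∫ p : ℂ × ℂ, G p.swap = ∫ p, G p := by
    rw [Measure.volume_eq_prod]
    exact integral_prod_swap G
  rw [integral_add hG hGs, hsw] at hle
  calc _ ≤ _ := hle
    _ ≤ 2 * (Real.log 2 / m * (8 * Real.pi * R) * ∫ x, |f x| * d x) := by linarith
    _ = _ := by ring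

end

/-! ### The radial part of the kernel -/

lemma abs_log_max_sub_log_max_le {r : ℝ} (hr : 0 < r) (a b : ℝ) :
    |Real.log (max r a) - Real.log (max r b)| ≤ r⁻¹ * |a - b| := by
  have key : ∀ a b : ℝ, Real.log (max r a) - Real.log (max r b) ≤ r⁻¹ * |a - b| := by
    intro a b
    have ha : 0 < max r a := lt_max_of_lt_left hr
    have hb : 0 < max r b := lt_max_of_lt_left hr
    rw [← Real.log_div ha.ne' hb.ne']
    calc Real.log (max r a / max r b) ≤ max r a / max r b - 1 :=
          Real.log_le_sub_one_of_pos (div_pos ha hb)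
      _ = (max r b)⁻¹ * (max r a - max r b) := by field_simp
      _ ≤ (max r b)⁻¹ * |a - b| := by
          gcongr
          refine (le_abs_self _).trans ?_
          rw [max_comm r a, max_comm r b]
          exact abs_max_sub_max_le_abs a b r
      _ ≤ r⁻¹ * |a - b| := by
          gcongr
          exact le_max_left _ _
  rw [abs_le]
  constructor
  · have := key b a
    rw [abs_sub_comm] at this
    linarith
  · exact key a b

/-- Interpolating `s ↦ log (max r s)` by a function `α + β s ^ 2` at the radii `r₁` and `r₂` leaves
an error controlled by the distance to these radii. -/
lemma exists_interpolation_log_max {r r₁ r₂ R : ℝ} (hr : 0 < r) (h₁ : 0 < r₁) (h₁₂ : r₁ < r₂)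
    (hR : r₂ ≤ R) : ∃ α β : ℝ, ∀ s : ℝ, 0 ≤ s → s ≤ R →
      |Real.log (max r s) - α - β * s ^ 2| ≤
        (1 + 2 * R / (r₁ + r₂)) * r⁻¹ * min |s - r₁| |s - r₂| := by
  have hΔ : 0 < r₂ ^ 2 - r₁ ^ 2 := sub_pos.mpr (pow_lt_pow_left₀ h₁₂ h₁.le two_ne_zero)
  set β := (Real.log (max r r₂) - Real.log (max r r₁)) / (r₂ ^ 2 - r₁ ^ 2) with hβ
  have hβΔ : β * (r₂ ^ 2 - r₁ ^ 2) = Real.log (max r r₂) - Real.log (max r r₁) :=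
    div_mul_cancel₀ _ hΔ.ne'
  have hβle : |β| ≤ r⁻¹ / (r₁ + r₂) := by
    rw [hβ, abs_div, abs_of_pos hΔ, div_le_div_iff₀ hΔ (by linarith)]
    have := abs_log_max_sub_log_max_le hr r₂ r₁
    rw [abs_of_pos (show 0 < r₂ - r₁ by linarith)] at this
    calc _ ≤ r⁻¹ * (r₂ - r₁) * (r₁ + r₂) := by gcongr; linarith
      _ = _ := by ring
  have key : ∀ ρ s : ℝ, 0 ≤ ρ → ρ ≤ R → 0 ≤ s → s ≤ R →
      |Real.log (max r s) - Real.log (max r ρ) - β * (s ^ 2 - ρ ^ 2)| ≤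
        (1 + 2 * R / (r₁ + r₂)) * r⁻¹ * |s - ρ| := by
    intro ρ s hρ hρR hs hsR
    have hsum : 0 < r₁ + r₂ := by linarith
    calc _ ≤ |Real.log (max r s) - Real.log (max r ρ)| + |β * (s ^ 2 - ρ ^ 2)| := abs_sub _ _
      _ ≤ r⁻¹ * |s - ρ| + r⁻¹ / (r₁ + r₂) * (2 * R * |s - ρ|) := by
          rw [abs_mul, show s ^ 2 - ρ ^ 2 = (s + ρ) * (s - ρ) by ring, abs_mul,
            abs_of_nonneg (add_nonneg hs hρ)]
          have := abs_log_max_sub_log_max_le hr s ρ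
          gcongr
          linarith
      _ = _ := by ring
  refine ⟨Real.log (max r r₁) - β * r₁ ^ 2, β, fun s hs hsR => ?_⟩
  rcases min_choice |s - r₁| |s - r₂| with h | h <;> rw [h]
  · convert key r₁ s h₁.le (by linarith) hs hsR using 2
    ring
  · convert key r₂ s (by linarith) hR hs hsR using 2
    linarith

/-- A density without mass and second moment interacts through the radial kernel only weakly:
the kernel may be corrected by `α(x) + β(x) ‖y‖ ^ 2` so as to vanish on both boundary circles. -/
lemma abs_integral_prod_mul_log_max_le {r₁ r₂ R : ℝ} (h₁ : 0 < r₁) (h₁₂ : r₁ < r₂) (hR : r₂ ≤ R)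
    {f : ℂ → ℝ} (hf : UnitBounded R f) (h0 : ∫ x, f x = 0) (h2 : ∫ x, f x * ‖x‖ ^ 2 = 0) :
    |∫ p : ℂ × ℂ, f p.1 * f p.2 * Real.log (max ‖p.1‖ ‖p.2‖)| ≤
      (1 + 2 * R / (r₁ + r₂)) * (∫ x, |f x| * ‖x‖⁻¹) * ∫ x, |f x| * radialGap r₁ r₂ x := by
  set D := ∫ x, |f x| * radialGap r₁ r₂ x
  have hint := hf.integrable_prod_mul hf (integrableOn_prod_log_max R)
  have hf2 : Integrable fun x => f x * ‖x‖ ^ 2 := hf.integrable_mul_continuous (by fun_prop)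
  rw [Measure.volume_eq_prod, integral_prod _ hint]
  have hrhs : (1 + 2 * R / (r₁ + r₂)) * (∫ x, |f x| * ‖x‖⁻¹) * D =
      ∫ x, (1 + 2 * R / (r₁ + r₂)) * D * (|f x| * ‖x‖⁻¹) := by
    rw [integral_const_mul]
    ring
  rw [hrhs, ← Real.norm_eq_abs]
  refine norm_integral_le_of_norm_le
    ((hf.abs.integrable_mul (integrableOn_inv_norm_ball R)).const_mul _) ?_
  have hne : ∀ᵐ x : ℂ, x ≠ 0 := by simp [ae_iff]
  filter_upwards [hne] with x hx
  obtain ⟨α, β, hαβ⟩ := exists_interpolation_log_max (norm_pos_iff.mpr hx) h₁ h₁₂ hR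
  have hmax : Integrable fun y => f y * Real.log (max ‖x‖ ‖y‖) :=
    hf.integrable_mul (integrableOn_log_max x R)
  have hsub : ∫ y, f y * Real.log (max ‖x‖ ‖y‖) =
      ∫ y, (f y * Real.log (max ‖x‖ ‖y‖) - α * f y - β * (f y * ‖y‖ ^ 2)) := by
    have hsub' : Integrable fun y => f y * Real.log (max ‖x‖ ‖y‖) - α * f y :=
      hmax.sub (hf.integrable.const_mul α)
    rw [integral_sub hsub' (hf2.const_mul β),
      integral_sub hmax (hf.integrable.const_mul α), integral_const_mul, integral_const_mul, h0, h2]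
    ring
  have hbound : |∫ y, f y * Real.log (max ‖x‖ ‖y‖)| ≤
      (1 + 2 * R / (r₁ + r₂)) * ‖x‖⁻¹ * D := by
    rw [hsub, ← Real.norm_eq_abs, ← integral_const_mul]
    refine norm_integral_le_of_norm_le (hf.abs.integrable_mul_radialGap.const_mul _)
      (ae_of_all _ fun y => ?_)
    rw [Real.norm_eq_abs]
    rcases le_or_gt R ‖y‖ with hy | hy
    · simp [hf.eq_zero y hy]
    · rw [show f y * Real.log (max ‖x‖ ‖y‖) - α * f y - β * (f y * ‖y‖ ^ 2) =
        f y * (Real.log (max ‖x‖ ‖y‖) - α - β * ‖y‖ ^ 2) by ring, abs_mul]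
      calc _ ≤ |f y| * ((1 + 2 * R / (r₁ + r₂)) * ‖x‖⁻¹ * radialGap r₁ r₂ y) :=
            mul_le_mul_of_nonneg_left (hαβ ‖y‖ (norm_nonneg y) hy.le) (abs_nonneg _)
        _ = _ := by ring
  simp_rw [mul_assoc (f x)]
  rw [integral_const_mul, Real.norm_eq_abs, abs_mul]
  calc _ ≤ |f x| * ((1 + 2 * R / (r₁ + r₂)) * ‖x‖⁻¹ * D) := by gcongr
    _ = _ := by ring

/-- The weight `‖x‖⁻¹` is locally integrable in the plane, so a bounded density of small mass has
a small integral against it. -/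
lemma exists_integral_abs_mul_inv_norm_le (R : ℝ) {δ : ℝ} (hδ : 0 < δ) :
    ∃ ε > 0, ∀ f : ℂ → ℝ, UnitBounded R f → ∫ x, |f x| < ε → ∫ x, |f x| * ‖x‖⁻¹ ≤ δ := by
  have hpi := Real.pi_pos
  set η := δ / (4 * Real.pi) with hη
  have hη0 : 0 < η := by positivity
  refine ⟨η * δ / 2, by positivity, fun f hf hε => ?_⟩
  have hball : ∫ x : ℂ, (ball (0 : ℂ) η).indicator (fun x => ‖x‖⁻¹) x = 2 * Real.pi * η := by
    have h1 : (fun x : ℂ => (ball (0 : ℂ) η).indicator (fun x => ‖x‖⁻¹) x) =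
        fun x => (Iio η).indicator (fun s : ℝ => s⁻¹) ‖x‖ := by
      ext x
      simp [indicator]
    rw [h1, integral_complex_radial]
    have h2 : ∫ s in Ioi (0 : ℝ), s * (Iio η).indicator (fun s : ℝ => s⁻¹) s =
        ∫ s in Ioi (0 : ℝ), (Iio η).indicator (fun _ => (1 : ℝ)) s := by
      refine setIntegral_congr_fun measurableSet_Ioi fun s hs => ?_
      have hs0 : s ≠ 0 := (mem_Ioi.mp hs).ne'
      by_cases h : s ∈ Iio η <;> simp [h, hs0]
    rw [h2, setIntegral_indicator measurableSet_Iio, Ioi_inter_Iio]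
    simp [hη0.le]
  have hind : Integrable fun x : ℂ => (ball (0 : ℂ) η).indicator (fun x => ‖x‖⁻¹) x :=
    (integrable_indicator_iff measurableSet_ball).mpr (integrableOn_inv_norm_ball η)
  have hle : ∫ x, |f x| * ‖x‖⁻¹ ≤
      ∫ x, (η⁻¹ * |f x| + (ball (0 : ℂ) η).indicator (fun x => ‖x‖⁻¹) x) := by
    refine integral_mono (hf.abs.integrable_mul (integrableOn_inv_norm_ball R))
      ((hf.abs.integrable.const_mul _).add hind) fun x => ?_
    have hfx := abs_nonneg (f x)
    dsimp only
    by_cases hx : x ∈ ball (0 : ℂ) η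
    · rw [indicator_of_mem hx]
      have h1 : |f x| * ‖x‖⁻¹ ≤ 1 * ‖x‖⁻¹ := by
        gcongr
        exact hf.abs_le x
      have h2 : 0 ≤ η⁻¹ * |f x| := by positivity
      linarith
    · rw [indicator_of_notMem hx, add_zero, mul_comm]
      have : η ≤ ‖x‖ := by simpa using hx
      gcongr
  rw [integral_add (hf.abs.integrable.const_mul _) hind, integral_const_mul, hball] at hle
  calc _ ≤ _ := hle
    _ ≤ η⁻¹ * (η * δ / 2) + 2 * Real.pi * η := by gcongr
    _ = δ := by
      rw [hη]
      field_simp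
      norm_num

/-- The self-interaction of an `m`-fold symmetric density without mass and second moment. The
averaged kernel is the sum of a radial part, a constant, and minus the excess kernel. -/
lemma integral_prod_mul_log_norm_sub_ge {r₁ r₂ R : ℝ} (h₁ : 0 < r₁) (h₁₂ : r₁ < r₂) (hR : r₂ ≤ R)
    {m : ℕ} (hm : 0 < m) {f : ℂ → ℝ} (hf : UnitBounded R f)
    (hsymm : ∀ c x : ℂ, c ^ m = 1 → f (c * x) = f x) (h0 : ∫ x, f x = 0)
    (h2 : ∫ x, f x * ‖x‖ ^ 2 = 0) :
    -(((1 + 2 * R / (r₁ + r₂)) * (∫ x, |f x| * ‖x‖⁻¹) + 16 * Real.pi * R * Real.log 2 / m) *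
      ∫ x, |f x| * radialGap r₁ r₂ x) ≤ ∫ p : ℂ × ℂ, f p.1 * f p.2 * Real.log ‖p.1 - p.2‖ := by
  have hm' : (m : ℝ) ≠ 0 := by exact_mod_cast hm.ne'
  have hI := integral_prod_mul_log_norm_sub_eq hm hf hsymm
  have hmax := hf.integrable_prod_mul hf (integrableOn_prod_log_max R)
  have hN := hf.integrable_prod_mul hf (integrableOn_excessKernel hm)
  have hff : Integrable fun p : ℂ × ℂ => f p.1 * f p.2 := hf.integrable.mul_prod hf.integrable
  have hff0 : ∫ p : ℂ × ℂ, f p.1 * f p.2 = 0 := by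
    rw [Measure.volume_eq_prod, integral_prod_mul, h0, zero_mul]
  have hdec : ∫ p : ℂ × ℂ, f p.1 * f p.2 * Real.log ‖p.1 ^ m - p.2 ^ m‖ =
      m * (∫ p : ℂ × ℂ, f p.1 * f p.2 * Real.log (max ‖p.1‖ ‖p.2‖)) -
        m * ∫ p : ℂ × ℂ, f p.1 * f p.2 * excessKernel m p := by
    have h : ∀ p : ℂ × ℂ, f p.1 * f p.2 * Real.log ‖p.1 ^ m - p.2 ^ m‖ =
        (m * (f p.1 * f p.2 * Real.log (max ‖p.1‖ ‖p.2‖)) + Real.log 2 * (f p.1 * f p.2)) -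
          m * (f p.1 * f p.2 * excessKernel m p) := by
      intro p
      rw [excessKernel]
      field_simp
      ring
    simp_rw [h]
    have hadd : Integrable fun p : ℂ × ℂ => m * (f p.1 * f p.2 * Real.log (max ‖p.1‖ ‖p.2‖)) +
      Real.log 2 * (f p.1 * f p.2) := (hmax.const_mul _).add (hff.const_mul _)
    rw [integral_sub hadd (hN.const_mul _), integral_add (hmax.const_mul _) (hff.const_mul _),
      integral_const_mul, integral_const_mul, integral_const_mul, hff0]
    ring
  rw [hdec, ← mul_sub] at hI
  have hI' := mul_left_cancel₀ hm' hI
  have hA := (abs_le.mp (abs_integral_prod_mul_log_max_le h₁ h₁₂ hR hf h0 h2)).1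
  have hB := integral_prod_mul_excessKernel_le (r₁ := r₁) (r₂ := r₂) hm (by linarith) hf
  rw [hI', add_mul]
  linarith

/-! ### The potential of the annulus -/

/-- The potential at radius `r` of the annulus with radii `r₁` and `r₂`, for the kernel
`log ‖x - y‖ / (2 * π)`. -/
noncomputable def ringPotential (r₁ r₂ r : ℝ) : ℝ := ∫ s in r₁..r₂, s * Real.log (max r s)

section

variable {r₁ r₂ r : ℝ}

lemma intervalIntegrable_mul_log_max {a b : ℝ} (ha : 0 < a) (hab : a ≤ b) :
    IntervalIntegrable (fun s => s * Real.log (max r s)) volume a b := by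
  refine ContinuousOn.intervalIntegrable ?_
  rw [uIcc_of_le hab]
  refine continuousOn_id.mul (ContinuousOn.log (by fun_prop) fun s hs => ?_)
  exact (lt_max_of_lt_right (ha.trans_le hs.1)).ne'

lemma integral_mul_log {a b : ℝ} (ha : 0 < a) (hab : a ≤ b) :
    ∫ s in a..b, s * Real.log s =
      (b ^ 2 / 2 * Real.log b - b ^ 2 / 4) - (a ^ 2 / 2 * Real.log a - a ^ 2 / 4) := by
  have hpos : ∀ s ∈ uIcc a b, s ≠ 0 := fun s hs => by
    rw [uIcc_of_le hab] at hs
    exact (ha.trans_le hs.1).ne'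
  refine intervalIntegral.integral_eq_sub_of_hasDerivAt
    (f := fun s => s ^ 2 / 2 * Real.log s - s ^ 2 / 4) (fun s hs => ?_) ?_
  · have h := ((((hasDerivAt_id s).pow 2).div_const 2).mul (Real.hasDerivAt_log (hpos s hs))).sub
      (((hasDerivAt_id s).pow 2).div_const 4)
    refine h.congr_deriv ?_
    have := hpos s hs
    simp only [id]
    field_simp
    simp
    ring
  · exact ContinuousOn.intervalIntegrable (continuousOn_id.mul (continuousOn_id.log hpos))

lemma integral_mul_log_max_of_le {a b : ℝ} (hab : a ≤ b) (hb : b ≤ r) :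
    ∫ s in a..b, s * Real.log (max r s) = (b ^ 2 - a ^ 2) / 2 * Real.log r := by
  have : ∫ s in a..b, s * Real.log (max r s) = ∫ s in a..b, s * Real.log r := by
    refine intervalIntegral.integral_congr fun s hs => ?_
    rw [uIcc_of_le hab] at hs
    simp only [max_eq_left (hs.2.trans hb)]
  rw [this, intervalIntegral.integral_mul_const, integral_id]

lemma integral_mul_log_max_of_ge {a b : ℝ} (ha : 0 < a) (hab : a ≤ b) (hr : r ≤ a) :
    ∫ s in a..b, s * Real.log (max r s) =
      (b ^ 2 / 2 * Real.log b - b ^ 2 / 4) - (a ^ 2 / 2 * Real.log a - a ^ 2 / 4) := by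
  rw [← integral_mul_log ha hab]
  refine intervalIntegral.integral_congr fun s hs => ?_
  rw [uIcc_of_le hab] at hs
  simp only [max_eq_right (hr.trans hs.1)]

lemma ringPotential_of_le (h₁ : 0 < r₁) (h₁₂ : r₁ < r₂) (hr : r ≤ r₁) :
    ringPotential r₁ r₂ r =
      (r₂ ^ 2 / 2 * Real.log r₂ - r₂ ^ 2 / 4) - (r₁ ^ 2 / 2 * Real.log r₁ - r₁ ^ 2 / 4) :=
  integral_mul_log_max_of_ge h₁ h₁₂.le hr

lemma ringPotential_of_mem_Icc (h₁ : 0 < r₁) (hr : r ∈ Icc r₁ r₂) :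
    ringPotential r₁ r₂ r =
      r₂ ^ 2 / 2 * Real.log r₂ - r₂ ^ 2 / 4 - r₁ ^ 2 / 2 * Real.log r + r ^ 2 / 4 := by
  have hr0 : 0 < r := h₁.trans_le hr.1
  rw [ringPotential, ← intervalIntegral.integral_add_adjacent_intervals
    (intervalIntegrable_mul_log_max h₁ hr.1) (intervalIntegrable_mul_log_max hr0 hr.2),
    integral_mul_log_max_of_le hr.1 le_rfl, integral_mul_log_max_of_ge hr0 hr.2 le_rfl]
  ring

lemma ringPotential_of_ge (h₁₂ : r₁ < r₂) (hr : r₂ ≤ r) :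
    ringPotential r₁ r₂ r = (r₂ ^ 2 - r₁ ^ 2) / 2 * Real.log r :=
  integral_mul_log_max_of_le h₁₂.le hr

/-- After subtracting a suitable `a + b r ^ 2`, the potential of the annulus is negative inside the
annulus and positive outside it, up to a radius beyond `r₂`, with nonzero slope at the boundary
circles: there it grows at least linearly. -/
lemma exists_ringPotential_gap (h₁ : 0 < r₁) (h₁₂ : r₁ < r₂) :
    ∃ a b c R : ℝ, 0 < c ∧ r₂ < R ∧
      (∀ r, 0 ≤ r → r ≤ R → ¬ (r₁ ≤ r ∧ r ≤ r₂) →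
        c * min |r - r₁| |r - r₂| ≤ ringPotential r₁ r₂ r - a - b * r ^ 2) ∧
      (∀ r, r₁ ≤ r ∧ r ≤ r₂ →
        ringPotential r₁ r₂ r - a - b * r ^ 2 ≤ -(c * min |r - r₁| |r - r₂|)) := by
  have h₂ : 0 < r₂ := h₁.trans h₁₂
  have hΔ : 0 < r₂ ^ 2 - r₁ ^ 2 := sub_pos.mpr (pow_lt_pow_left₀ h₁₂ h₁.le two_ne_zero)
  set L := Real.log r₂ - Real.log r₁ with hL
  have hL0 : 0 < L := sub_pos.mpr (Real.log_lt_log h₁ h₁₂)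
  -- with `t = r₂ / r₁`, these are `log t² < t² - 1` and `1 - t⁻² < log t²`
  have hup : 2 * r₁ ^ 2 * L < r₂ ^ 2 - r₁ ^ 2 := by
    have h := Real.log_lt_sub_one_of_pos (x := r₂ ^ 2 / r₁ ^ 2) (by positivity)
      (by rw [ne_eq, div_eq_one_iff_eq (by positivity)]; linarith)
    rw [Real.log_div (by positivity) (by positivity), Real.log_pow, Real.log_pow,
      ← mul_lt_mul_iff_right₀ (show 0 < r₁ ^ 2 by positivity)] at h
    have e : r₁ ^ 2 * (r₂ ^ 2 / r₁ ^ 2 - 1) = r₂ ^ 2 - r₁ ^ 2 := by field_simp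
    rw [e] at h
    push_cast at h
    rw [hL]
    linarith
  have hlow : r₂ ^ 2 - r₁ ^ 2 < 2 * r₂ ^ 2 * L := by
    have h := Real.log_lt_sub_one_of_pos (x := r₁ ^ 2 / r₂ ^ 2) (by positivity)
      (by rw [ne_eq, div_eq_one_iff_eq (by positivity)]; linarith)
    rw [Real.log_div (by positivity) (by positivity), Real.log_pow, Real.log_pow,
      ← mul_lt_mul_iff_right₀ (show 0 < r₂ ^ 2 by positivity)] at h
    have e : r₂ ^ 2 * (r₁ ^ 2 / r₂ ^ 2 - 1) = r₁ ^ 2 - r₂ ^ 2 := by field_simp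
    rw [e] at h
    push_cast at h
    rw [hL]
    linarith
  set B := r₁ ^ 2 * L / (2 * (r₂ ^ 2 - r₁ ^ 2)) with hB
  have hB0 : 0 < B := by positivity
  have hBΔ : B * (r₂ ^ 2 - r₁ ^ 2) = r₁ ^ 2 / 2 * L := by rw [hB]; field_simp
  set b := 1 / 4 - B with hb
  have hb0 : 0 < b := by
    have : B < 1 / 4 := by
      rw [hB, div_lt_iff₀ (by positivity)]
      linarith
    linarith
  -- the slope of the corrected potential at the outer circle
  set κ := (r₂ ^ 2 - r₁ ^ 2) / (2 * r₂) - b * (r₂ + r₂) with hκ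
  have hκ0 : 0 < κ := by
    have h : 4 * b * r₂ ^ 2 < r₂ ^ 2 - r₁ ^ 2 := by
      have e : 4 * b * r₂ ^ 2 * (r₂ ^ 2 - r₁ ^ 2) =
          r₂ ^ 2 * (r₂ ^ 2 - r₁ ^ 2) - r₁ ^ 2 * (2 * r₂ ^ 2 * L) := by
        rw [hb]
        linear_combination (-4 * r₂ ^ 2) * hBΔ
      have := mul_lt_mul_of_pos_left hlow (show 0 < r₁ ^ 2 by positivity)
      refine lt_of_mul_lt_mul_right (a := r₂ ^ 2 - r₁ ^ 2) ?_ hΔ.le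
      rw [e]
      linarith
    rw [hκ, sub_pos, lt_div_iff₀ (by positivity)]
    linarith
  obtain ⟨R, hR₂, hR⟩ : ∃ R, r₂ < R ∧ κ / 2 < (r₂ ^ 2 - r₁ ^ 2) / (2 * R) - b * (R + r₂) := by
    have hcont : ContinuousAt (fun R => (r₂ ^ 2 - r₁ ^ 2) / (2 * R) - b * (R + r₂)) r₂ :=
      (continuousAt_const.div (by fun_prop) (by positivity)).sub (by fun_prop)
    have hev := hcont.eventually (lt_mem_nhds (show κ / 2 < κ by linarith))
    exact ((hev.filter_mono nhdsWithin_le_nhds).and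
      (self_mem_nhdsWithin (s := Ioi r₂))).exists.imp fun _ h => ⟨h.2, h.1⟩
  set c := min (b * r₁) (min (B * (r₂ - r₁) / 2) (κ / 2)) with hc
  have hc1 : c ≤ b * r₁ := min_le_left _ _
  have hc2 : c ≤ B * (r₂ - r₁) / 2 := (min_le_right _ _).trans (min_le_left _ _)
  have hc3 : c ≤ κ / 2 := (min_le_right _ _).trans (min_le_right _ _)
  have hc0 : 0 < c := by
    have : 0 < r₂ - r₁ := by linarith
    refine lt_min (by positivity) (lt_min (by positivity) (by positivity))
  refine ⟨(r₂ ^ 2 / 2 * Real.log r₂ - r₂ ^ 2 / 4) - (r₁ ^ 2 / 2 * Real.log r₁ - r₁ ^ 2 / 4) -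
    b * r₁ ^ 2, b, c, R, hc0, hR₂, fun r hr0 hrR hr => ?_, fun r hr => ?_⟩
  · rcases lt_or_ge r r₁ with h | h
    · rw [ringPotential_of_le h₁ h₁₂ h.le]
      calc c * min |r - r₁| |r - r₂| ≤ b * r₁ * |r - r₁| := by
            gcongr
            exact min_le_left _ _
        _ = b * r₁ * (r₁ - r) := by rw [abs_of_neg (by linarith), neg_sub]
        _ ≤ b * (r₁ + r) * (r₁ - r) := by gcongr; linarith
        _ = _ := by ring
    · have h' : r₂ < r := not_le.mp fun h' => hr ⟨h, h'⟩
      have hrpos : 0 < r := h₂.trans h'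
      rw [ringPotential_of_ge h₁₂ h'.le]
      have hlog : (r - r₂) / r ≤ Real.log r - Real.log r₂ := by
        rw [← Real.log_div hrpos.ne' h₂.ne']
        refine le_trans (le_of_eq ?_) (Real.one_sub_inv_le_log_of_pos (div_pos hrpos h₂))
        field_simp
      have hslope : c ≤ (r₂ ^ 2 - r₁ ^ 2) / (2 * r) - b * (r + r₂) := by
        have e1 : (r₂ ^ 2 - r₁ ^ 2) / (2 * R) ≤ (r₂ ^ 2 - r₁ ^ 2) / (2 * r) := by gcongr
        have e2 : b * (r + r₂) ≤ b * (R + r₂) := by gcongr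
        linarith
      calc c * min |r - r₁| |r - r₂| ≤ c * |r - r₂| := by
            gcongr
            exact min_le_right _ _
        _ = c * (r - r₂) := by rw [abs_of_pos (by linarith)]
        _ ≤ ((r₂ ^ 2 - r₁ ^ 2) / (2 * r) - b * (r + r₂)) * (r - r₂) := by gcongr
        _ = (r₂ ^ 2 - r₁ ^ 2) / 2 * ((r - r₂) / r) - b * (r ^ 2 - r₂ ^ 2) := by
            field_simp
            ring
        _ ≤ (r₂ ^ 2 - r₁ ^ 2) / 2 * (Real.log r - Real.log r₂) - b * (r ^ 2 - r₂ ^ 2) := by gcongr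
        _ = _ := by
            rw [hb]
            rw [hL] at hBΔ
            linear_combination -hBΔ
  · obtain ⟨hr1, hr2⟩ := hr
    have hrpos : 0 < r := h₁.trans_le hr1
    rw [ringPotential_of_mem_Icc h₁ ⟨hr1, hr2⟩]
    have hd : 0 < r₂ - r₁ := by linarith
    have hconc : (r - r₁) / (r₂ - r₁) * L ≤ Real.log r - Real.log r₁ := by
      have h := strictConcaveOn_log_Ioi.concaveOn.2 (mem_Ioi.mpr h₁) (mem_Ioi.mpr h₂)
        (show 0 ≤ (r₂ - r) / (r₂ - r₁) from div_nonneg (by linarith) hd.le)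
        (show 0 ≤ (r - r₁) / (r₂ - r₁) from div_nonneg (by linarith) hd.le)
        (by field_simp; ring)
      have e : (r₂ - r) / (r₂ - r₁) * r₁ + (r - r₁) / (r₂ - r₁) * r₂ = r := by
        field_simp
        ring
      have e' : (r₂ - r) / (r₂ - r₁) = 1 - (r - r₁) / (r₂ - r₁) := by
        field_simp
        ring
      simp only [smul_eq_mul] at h
      rw [e, e'] at h
      rw [hL]
      linarith
    have hprod : B * (r - r₁) * (r₂ - r) ≤
        r₁ ^ 2 / 2 * (Real.log r - Real.log r₁) - B * (r ^ 2 - r₁ ^ 2) := by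
      calc B * (r - r₁) * (r₂ - r) = r₁ ^ 2 / 2 * ((r - r₁) / (r₂ - r₁) * L)
            - B * (r ^ 2 - r₁ ^ 2) := by
            have : r₁ ^ 2 / 2 * ((r - r₁) / (r₂ - r₁) * L) = (r - r₁) * (B * (r₂ + r₁)) := by
              rw [show r₁ ^ 2 / 2 * ((r - r₁) / (r₂ - r₁) * L) =
                (r - r₁) / (r₂ - r₁) * (r₁ ^ 2 / 2 * L) by ring, ← hBΔ]
              field_simp
              ring
            rw [this]
            ring
        _ ≤ _ := by gcongr
    have hmin : c * min |r - r₁| |r - r₂| ≤ B * (r - r₁) * (r₂ - r) := by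
      have hn : 0 ≤ min |r - r₁| |r - r₂| := le_min (abs_nonneg _) (abs_nonneg _)
      refine (mul_le_mul_of_nonneg_right hc2 hn).trans ?_
      rw [abs_of_nonneg (by linarith), abs_of_nonpos (by linarith)] at *
      rcases le_total (r - r₁) (-(r - r₂)) with h | h
      · rw [min_eq_left h]
        have := mul_le_mul_of_nonneg_left (show (r₂ - r₁) / 2 ≤ r₂ - r by linarith)
          (mul_nonneg hB0.le (show 0 ≤ r - r₁ by linarith))
        linarith
      · rw [min_eq_right h]
        have := mul_le_mul_of_nonneg_left (show (r₂ - r₁) / 2 ≤ r - r₁ by linarith)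
          (mul_nonneg hB0.le (show 0 ≤ r₂ - r by linarith))
        linarith
    rw [hb]
    linarith

end

/-- The characteristic function of the annulus with radii `r₁` and `r₂` in the complex plane. -/
noncomputable def annulusC (r₁ r₂ : ℝ) : ℂ → ℝ :=
  {x : ℂ | r₁ ≤ ‖x‖ ∧ ‖x‖ ≤ r₂}.indicator fun _ => 1

section

variable {r₁ r₂ R : ℝ}

lemma unitBounded_annulusC (hR : r₂ < R) : UnitBounded R (annulusC r₁ r₂) :=
  unitBounded_indicator ((measurableSet_le measurable_const measurable_norm).inter
    (measurableSet_le measurable_norm measurable_const)).nullMeasurableSet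
    fun _ h => h.2.trans_lt hR

lemma integral_annulusC_mul_log_norm_sub (h₁ : 0 < r₁) (h₁₂ : r₁ < r₂) (x : ℂ) :
    ∫ y, annulusC r₁ r₂ y * Real.log ‖x - y‖ = 2 * Real.pi * ringPotential r₁ r₂ ‖x‖ := by
  rw [integral_radial_mul_log_norm_sub (unitBounded_annulusC (lt_add_one r₂))
    (fun c y hc => by simp [annulusC, indicator, hc]) x]
  have h : ∀ y : ℂ, annulusC r₁ r₂ y * Real.log (max ‖x‖ ‖y‖) =
      (fun s : ℝ => (Icc r₁ r₂).indicator (fun s => Real.log (max ‖x‖ s)) s) ‖y‖ := by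
    intro y
    simp [annulusC, indicator]
  simp_rw [h]
  rw [integral_complex_radial, ringPotential, intervalIntegral.integral_of_le h₁₂.le,
    ← integral_Icc_eq_integral_Ioc]
  have h' : ∀ s : ℝ, s * (Icc r₁ r₂).indicator (fun s => Real.log (max ‖x‖ s)) s =
      (Icc r₁ r₂).indicator (fun s => s * Real.log (max ‖x‖ s)) s := by
    intro s
    by_cases hs : s ∈ Icc r₁ r₂ <;> simp [hs]
  simp_rw [h']
  rw [setIntegral_indicator measurableSet_Icc,
    inter_eq_self_of_subset_right (show Icc r₁ r₂ ⊆ Ioi 0 from fun s hs => h₁.trans_le hs.1)]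

/-! ### Stability in the complex plane -/

/-- Expansion of the interaction energy of `f + g` in powers of `g`. -/
lemma integral_prod_mul_log_norm_sub_add {f g : ℂ → ℝ} (hf : UnitBounded R f)
    (hg : UnitBounded R g) :
    ∫ p : ℂ × ℂ, (f p.1 + g p.1) * (f p.2 + g p.2) * Real.log ‖p.1 - p.2‖ =
      (∫ p : ℂ × ℂ, f p.1 * f p.2 * Real.log ‖p.1 - p.2‖) +
        2 * (∫ x, g x * ∫ y, f y * Real.log ‖x - y‖) +
        ∫ p : ℂ × ℂ, g p.1 * g p.2 * Real.log ‖p.1 - p.2‖ := by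
  have hk : IntegrableOn (fun p : ℂ × ℂ => Real.log ‖p.1 - p.2‖) (ball 0 R ×ˢ ball 0 R) := by
    simpa using integrableOn_prod_log_norm_sub (c := 1) (by simp) R
  have hff := hf.integrable_prod_mul hf hk
  have hfg := hf.integrable_prod_mul hg hk
  have hgf := hg.integrable_prod_mul hf hk
  have hgg := hg.integrable_prod_mul hg hk
  have hswap : ∫ p : ℂ × ℂ, f p.1 * g p.2 * Real.log ‖p.1 - p.2‖ =
      ∫ p : ℂ × ℂ, g p.1 * f p.2 * Real.log ‖p.1 - p.2‖ := by
    rw [Measure.volume_eq_prod, ← integral_prod_swap]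
    refine integral_congr_ae (ae_of_all _ fun p => ?_)
    simp only [Prod.fst_swap, Prod.snd_swap]
    rw [norm_sub_rev, mul_comm (f p.2)]
  have hiter : ∫ p : ℂ × ℂ, g p.1 * f p.2 * Real.log ‖p.1 - p.2‖ =
      ∫ x, g x * ∫ y, f y * Real.log ‖x - y‖ := by
    rw [Measure.volume_eq_prod, integral_prod _ hgf]
    simp_rw [mul_assoc, integral_const_mul]
  have hexp : ∀ p : ℂ × ℂ, (f p.1 + g p.1) * (f p.2 + g p.2) * Real.log ‖p.1 - p.2‖ =
      (f p.1 * f p.2 * Real.log ‖p.1 - p.2‖ + f p.1 * g p.2 * Real.log ‖p.1 - p.2‖) +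
      (g p.1 * f p.2 * Real.log ‖p.1 - p.2‖ + g p.1 * g p.2 * Real.log ‖p.1 - p.2‖) :=
    fun p => by ring
  simp_rw [hexp]
  have hl : Integrable fun p : ℂ × ℂ => f p.1 * f p.2 * Real.log ‖p.1 - p.2‖ +
      f p.1 * g p.2 * Real.log ‖p.1 - p.2‖ := hff.add hfg
  have hr : Integrable fun p : ℂ × ℂ => g p.1 * f p.2 * Real.log ‖p.1 - p.2‖ +
      g p.1 * g p.2 * Real.log ‖p.1 - p.2‖ := hgf.add hgg
  rw [integral_add hl hr, integral_add hff hfg, integral_add hgf hgg, hswap,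
    hiter]
  ring

/-- The linear term of the expansion around the annulus: by the constraints the potential may be
corrected by `a + b ‖x‖ ^ 2`, after which it has the sign of the perturbation. -/
lemma le_integral_mul_integral_annulusC (h₁ : 0 < r₁) (h₁₂ : r₁ < r₂) {a b c : ℝ} (hR : r₂ < R)
    (hout : ∀ r, 0 ≤ r → r ≤ R → ¬ (r₁ ≤ r ∧ r ≤ r₂) →
      c * min |r - r₁| |r - r₂| ≤ ringPotential r₁ r₂ r - a - b * r ^ 2)
    (hin : ∀ r, r₁ ≤ r ∧ r ≤ r₂ →
      ringPotential r₁ r₂ r - a - b * r ^ 2 ≤ -(c * min |r - r₁| |r - r₂|))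
    {f : ℂ → ℝ} (hf : UnitBounded R f) (h0 : ∫ x, f x = 0) (h2 : ∫ x, f x * ‖x‖ ^ 2 = 0)
    (hfin : ∀ x, r₁ ≤ ‖x‖ ∧ ‖x‖ ≤ r₂ → f x ≤ 0)
    (hfout : ∀ x, ¬ (r₁ ≤ ‖x‖ ∧ ‖x‖ ≤ r₂) → 0 ≤ f x) :
    2 * Real.pi * c * ∫ x, |f x| * radialGap r₁ r₂ x ≤
      ∫ x, f x * ∫ y, annulusC r₁ r₂ y * Real.log ‖x - y‖ := by
  have hpi := Real.pi_pos
  have hk : IntegrableOn (fun p : ℂ × ℂ => Real.log ‖p.1 - p.2‖) (ball 0 R ×ˢ ball 0 R) := by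
    simpa using integrableOn_prod_log_norm_sub (c := 1) (by simp) R
  have hint : Integrable fun x => f x * ringPotential r₁ r₂ ‖x‖ := by
    have h := (hf.integrable_prod_mul (unitBounded_annulusC (r₁ := r₁) hR) hk).integral_prod_left
    simp_rw [mul_assoc, integral_const_mul, integral_annulusC_mul_log_norm_sub h₁ h₁₂] at h
    refine (h.const_mul (2 * Real.pi)⁻¹).congr (ae_of_all _ fun x => ?_)
    dsimp only
    field_simp
  have hf2 : Integrable fun x => f x * ‖x‖ ^ 2 := hf.integrable_mul_continuous (by fun_prop)
  have hsub : ∫ x, f x * ringPotential r₁ r₂ ‖x‖ =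
      ∫ x, (f x * ringPotential r₁ r₂ ‖x‖ - a * f x - b * (f x * ‖x‖ ^ 2)) := by
    have hsub' : Integrable fun x => f x * ringPotential r₁ r₂ ‖x‖ - a * f x :=
      hint.sub (hf.integrable.const_mul a)
    rw [integral_sub hsub' (hf2.const_mul b), integral_sub hint (hf.integrable.const_mul a),
      integral_const_mul, integral_const_mul, h0, h2]
    ring
  have hle : ∫ x, c * (|f x| * radialGap r₁ r₂ x) ≤
      ∫ x, (f x * ringPotential r₁ r₂ ‖x‖ - a * f x - b * (f x * ‖x‖ ^ 2)) := by
    refine integral_mono (hf.abs.integrable_mul_radialGap.const_mul c)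
      ((hint.sub (hf.integrable.const_mul a)).sub (hf2.const_mul b)) fun x => ?_
    dsimp only
    rw [show f x * ringPotential r₁ r₂ ‖x‖ - a * f x - b * (f x * ‖x‖ ^ 2) =
      f x * (ringPotential r₁ r₂ ‖x‖ - a - b * ‖x‖ ^ 2) by ring]
    by_cases hx : r₁ ≤ ‖x‖ ∧ ‖x‖ ≤ r₂
    · have h := mul_le_mul_of_nonneg_left (hin ‖x‖ hx) (neg_nonneg.mpr (hfin x hx))
      rw [abs_of_nonpos (hfin x hx), radialGap]
      linarith
    · rcases le_or_gt R ‖x‖ with hxR | hxR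
      · simp [hf.eq_zero x hxR]
      · have h := mul_le_mul_of_nonneg_left (hout ‖x‖ (norm_nonneg x) hxR.le hx) (hfout x hx)
        rw [abs_of_nonneg (hfout x hx), radialGap]
        linarith
  simp_rw [integral_annulusC_mul_log_norm_sub h₁ h₁₂]
  rw [← hsub, integral_const_mul] at hle
  have h : ∀ x, f x * (2 * Real.pi * ringPotential r₁ r₂ ‖x‖) =
      2 * Real.pi * (f x * ringPotential r₁ r₂ ‖x‖) := fun x => by ring
  simp_rw [h]
  rw [integral_const_mul, mul_assoc]
  gcongr

/-- Quantitative maximality of the annulus among symmetric patches in the complex plane. -/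
theorem exists_stability_complex (h₁ : 0 < r₁) (h₁₂ : r₁ < r₂) :
    ∃ (m : ℕ) (R ε c : ℝ), 2 ≤ m ∧ r₂ < R ∧ 0 < ε ∧ 0 < c ∧
      ∀ A : Set ℂ, NullMeasurableSet A → A ⊆ ball 0 R →
        (∀ ζ x : ℂ, ζ ^ m = 1 →
          A.indicator (fun _ => (1 : ℝ)) (ζ * x) = A.indicator (fun _ => (1 : ℝ)) x) →
        ∫ x, A.indicator (fun _ => (1 : ℝ)) x = ∫ x, annulusC r₁ r₂ x →
        ∫ x, ‖x‖ ^ 2 * A.indicator (fun _ => (1 : ℝ)) x = ∫ x, ‖x‖ ^ 2 * annulusC r₁ r₂ x →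
        ∫ x, |A.indicator (fun _ => (1 : ℝ)) x - annulusC r₁ r₂ x| < ε →
        c * (∫ x, |A.indicator (fun _ => (1 : ℝ)) x - annulusC r₁ r₂ x|) ^ 2 ≤
          1 / (4 * Real.pi) * ((∫ p : ℂ × ℂ, A.indicator (fun _ => (1 : ℝ)) p.1 *
            A.indicator (fun _ => (1 : ℝ)) p.2 * Real.log ‖p.1 - p.2‖) -
          ∫ p : ℂ × ℂ, annulusC r₁ r₂ p.1 * annulusC r₁ r₂ p.2 * Real.log ‖p.1 - p.2‖) := by
  have hpi := Real.pi_pos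
  obtain ⟨a, b, c, R, hc, hR, hout, hin⟩ := exists_ringPotential_gap h₁ h₁₂
  have hR0 : 0 < R := h₁.trans (h₁₂.trans hR)
  set K := 1 + 2 * R / (r₁ + r₂) with hK
  have hK0 : 0 < K := by
    have : 0 < r₁ + r₂ := by linarith
    positivity
  -- `m` large and `ε` small make the two error terms at most a quarter of the linear term each
  obtain ⟨m, hm⟩ := exists_nat_gt (max 2 (16 * R * Real.log 2 / c))
  have hm2 : 2 < m := by exact_mod_cast (le_max_left _ _).trans_lt hm
  have hmc : 16 * Real.pi * R * Real.log 2 / m ≤ Real.pi * c := by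
    have h := (le_max_right _ _).trans_lt hm
    rw [div_lt_iff₀ hc] at h
    rw [div_le_iff₀ (by positivity)]
    have := mul_le_mul_of_nonneg_left h.le hpi.le
    linarith
  obtain ⟨ε, hε, hsmall⟩ := exists_integral_abs_mul_inv_norm_le R
    (show 0 < Real.pi * c / K by positivity)
  refine ⟨m, R, ε, c / (64 * Real.pi * R), hm2.le, hR, hε, by positivity,
    fun A hA hAR hsymm hmass himp hdist => ?_⟩
  set ω : ℂ → ℝ := A.indicator fun _ => 1 with hω
  set f : ℂ → ℝ := fun x => ω x - annulusC r₁ r₂ x with hf_def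
  have hω01 : ∀ x, 0 ≤ ω x ∧ ω x ≤ 1 := fun x => by
    by_cases hx : x ∈ A <;> simp [hω, hx]
  have hωR : UnitBounded R ω := unitBounded_indicator hA fun x hx => by simpa using hAR hx
  have hring := unitBounded_annulusC (r₁ := r₁) hR
  have hring1 : ∀ x : ℂ, r₁ ≤ ‖x‖ ∧ ‖x‖ ≤ r₂ → annulusC r₁ r₂ x = 1 := fun x hx => by
    simp [annulusC, hx.1, hx.2]
  have hring0 : ∀ x : ℂ, ¬ (r₁ ≤ ‖x‖ ∧ ‖x‖ ≤ r₂) → annulusC r₁ r₂ x = 0 := fun x hx =>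
    indicator_of_notMem (s := {x : ℂ | r₁ ≤ ‖x‖ ∧ ‖x‖ ≤ r₂}) hx _
  have hfin : ∀ x, r₁ ≤ ‖x‖ ∧ ‖x‖ ≤ r₂ → f x ≤ 0 := fun x hx => by
    simp only [hf_def, hring1 x hx]
    linarith [(hω01 x).2]
  have hfout : ∀ x, ¬ (r₁ ≤ ‖x‖ ∧ ‖x‖ ≤ r₂) → 0 ≤ f x := fun x hx => by
    simp only [hf_def, hring0 x hx]
    linarith [(hω01 x).1]
  have hf : UnitBounded R f := by
    refine ⟨hωR.meas.sub hring.meas, fun x => ?_, fun x hx => ?_⟩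
    · rw [abs_le]
      by_cases hx : r₁ ≤ ‖x‖ ∧ ‖x‖ ≤ r₂
      · simp only [hf_def, hring1 x hx]
        constructor <;> linarith [(hω01 x).1, (hω01 x).2]
      · simp only [hf_def, hring0 x hx]
        constructor <;> linarith [(hω01 x).1, (hω01 x).2]
    · simp [hf_def, hωR.eq_zero x hx, hring.eq_zero x hx]
  have hfsymm : ∀ ζ x : ℂ, ζ ^ m = 1 → f (ζ * x) = f x := fun ζ x hζ => by
    have hn := Complex.norm_eq_one_of_pow_eq_one hζ (by lia)
    simp only [hf_def, hsymm ζ x hζ]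
    simp [annulusC, indicator, hn]
  have h0 : ∫ x, f x = 0 := by
    rw [integral_sub hωR.integrable hring.integrable, hmass, sub_self]
  have h2 : ∫ x, f x * ‖x‖ ^ 2 = 0 := by
    have e : ∀ x, f x * ‖x‖ ^ 2 = ω x * ‖x‖ ^ 2 - annulusC r₁ r₂ x * ‖x‖ ^ 2 := fun x => by
      simp only [hf_def]
      ring
    simp_rw [e]
    rw [integral_sub (hωR.integrable_mul_continuous (by fun_prop))
      (hring.integrable_mul_continuous (by fun_prop))]
    simp_rw [mul_comm _ (‖_‖ ^ 2)]
    rw [himp, sub_self]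
  set D := ∫ x, |f x| * radialGap r₁ r₂ x
  have hD : 0 ≤ D := integral_nonneg fun x => mul_nonneg (abs_nonneg _) (radialGap_nonneg x)
  have hlin := le_integral_mul_integral_annulusC h₁ h₁₂ hR hout hin hf h0 h2 hfin hfout
  have hquad := integral_prod_mul_log_norm_sub_ge h₁ h₁₂ hR.le (by lia : 0 < m) hf hfsymm h0 h2
  have hexp := integral_prod_mul_log_norm_sub_add hring hf
  simp only [hf_def, add_sub_cancel] at hexp
  have hbath := sq_integral_abs_le_integral_mul_radialGap (r₁ := r₁) (r₂ := r₂) hR0 hf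
  have hcoef : K * (∫ x, |f x| * ‖x‖⁻¹) + 16 * Real.pi * R * Real.log 2 / m ≤
      2 * (Real.pi * c) := by
    have h := mul_le_mul_of_nonneg_left (hsmall f hf hdist) hK0.le
    rw [mul_div_cancel₀ _ hK0.ne'] at h
    linarith
  have hquad' := mul_le_mul_of_nonneg_right hcoef hD
  rw [hexp]
  calc c / (64 * Real.pi * R) * (∫ x, |f x|) ^ 2
      ≤ c / (64 * Real.pi * R) * (32 * Real.pi * R * D) := by gcongr
    _ = 1 / (4 * Real.pi) * (2 * Real.pi * c * D) := by field_simp; ring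
    _ ≤ _ := by
      gcongr
      linarith

end

/-! ### Transfer to the Euclidean plane -/

/-- The identification of the complex plane with the Euclidean plane. -/
noncomputable def ofComplex : ℂ ≃ₗᵢ[ℝ] Plane := Complex.orthonormalBasisOneI.repr

lemma integral_plane (F : Plane → ℝ) : ∫ x, F x = ∫ z, F (ofComplex z) :=
  (Complex.orthonormalBasisOneI.measurePreserving_repr.integral_comp
    ofComplex.toHomeomorph.measurableEmbedding F).symm

lemma rotation_ofComplex (α : ℝ) (z : ℂ) :
    rotation α (ofComplex z) = ofComplex (Complex.exp (α * Complex.I) * z) := by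
  ext i
  fin_cases i <;>
    simp [rotation, ofComplex, Complex.exp_ofReal_mul_I_re, Complex.exp_ofReal_mul_I_im]
  ring

lemma energy_eq_integral_prod {R : ℝ} {ω : Plane → ℝ}
    (hω : UnitBounded R fun z => ω (ofComplex z)) :
    energy ω = -(1 / (4 * Real.pi)) * ∫ p : ℂ × ℂ,
      ω (ofComplex p.1) * ω (ofComplex p.2) * Real.log ‖p.1 - p.2‖ := by
  have hk : IntegrableOn (fun p : ℂ × ℂ => Real.log ‖p.1 - p.2‖) (ball 0 R ×ˢ ball 0 R) := by
    simpa using integrableOn_prod_log_norm_sub (c := 1) (by simp) R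
  have hstream : ∀ z, stream ω (ofComplex z) =
      -(1 / (2 * Real.pi)) * ∫ w, ω (ofComplex w) * Real.log ‖z - w‖ := by
    intro z
    rw [stream, integral_plane]
    have : ∀ w, Real.log (1 / ‖ofComplex z - ofComplex w‖) * ω (ofComplex w) =
        -(ω (ofComplex w) * Real.log ‖z - w‖) := by
      intro w
      rw [← map_sub, ofComplex.norm_map, one_div, Real.log_inv]
      ring
    simp_rw [this]
    rw [integral_neg]
    ring
  rw [Measure.volume_eq_prod, integral_prod _ (hω.integrable_prod_mul hω hk), energy,
    integral_plane]
  simp_rw [hstream, mul_assoc, integral_const_mul, mul_left_comm (ω (ofComplex _)),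
    integral_const_mul]
  ring

lemma annulus_ofComplex (r₁ r₂ : ℝ) (z : ℂ) : annulus r₁ r₂ (ofComplex z) = annulusC r₁ r₂ z := by
  simp [annulus, patch, annulusC, indicator]

lemma IsFoldSymmetric.ofComplex_mul {m : ℕ} (hm : m ≠ 0) {ω : Plane → ℝ}
    (hω : IsFoldSymmetric m ω) {ζ : ℂ} (hζ : ζ ^ m = 1) (z : ℂ) :
    ω (ofComplex (ζ * z)) = ω (ofComplex z) := by
  have : NeZero m := ⟨hm⟩
  obtain ⟨k, -, rfl⟩ := (Complex.isPrimitiveRoot_exp m hm).eq_pow_of_pow_eq_one hζ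
  clear hζ
  induction k with
  | zero => simp
  | succ k ih =>
    rw [← ih, pow_succ', mul_assoc, ← hω (ofComplex (Complex.exp _ ^ k * z)), rotation_ofComplex]
    push_cast
    rw [div_mul_eq_mul_div]

end EulerPatch

theorem mainTheorem6 (r₁ r₂ : ℝ) (hr₁ : 0 < r₁) (hr₂ : r₁ < r₂) :
    ∃ (m : ℕ) (rbar ε₀ c₀ : ℝ), 2 ≤ m ∧ 1 < rbar ∧ 0 < ε₀ ∧ 0 < c₀ ∧
      ∀ ε : ℝ, 0 < ε → ε < ε₀ →
        ∀ ω ∈ EulerPatch.admissibleFold m (EulerPatch.annulus r₁ r₂) ∩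
            EulerPatch.neighborhood ε (Metric.ball 0 (rbar * r₂)) (EulerPatch.annulus r₁ r₂),
          c₀ * EulerPatch.distL1 (EulerPatch.annulus r₁ r₂) ω ^ 2 ≤
            EulerPatch.energy (EulerPatch.annulus r₁ r₂) - EulerPatch.energy ω := by
  open EulerPatch in
  have h₂ : 0 < r₂ := hr₁.trans hr₂
  obtain ⟨m, R, ε₀, c₀, hm, hR, hε₀, hc₀, H⟩ := exists_stability_complex hr₁ hr₂
  refine ⟨m, R / r₂, ε₀, c₀, hm, (one_lt_div h₂).mpr hR, hε₀, hc₀, fun ε _ hεε₀ ω hω => ?_⟩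
  rw [div_mul_cancel₀ _ h₂.ne'] at hω
  obtain ⟨⟨⟨-, hmass, himp⟩, hsymm⟩, ⟨A, hA, hAR, rfl⟩, hdist⟩ := hω
  set A' : Set ℂ := ofComplex ⁻¹' A
  have hA'R : A' ⊆ Metric.ball 0 R := fun z hz => by simpa using hAR hz
  have hA' : NullMeasurableSet A' :=
    hA.preimage Complex.orthonormalBasisOneI.measurePreserving_repr.quasiMeasurePreserving
  have hpatch : ∀ z, patch A (ofComplex z) = A'.indicator (fun _ => (1 : ℝ)) z := fun z => rfl
  have hEω := energy_eq_integral_prod (R := R) (ω := patch A)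
    (unitBounded_indicator hA' fun z hz => by simpa using hA'R hz)
  have hEr := energy_eq_integral_prod (R := R) (ω := annulus r₁ r₂) (by
    simpa only [annulus_ofComplex] using unitBounded_annulusC hR)
  simp only [integral_plane, annulus_ofComplex, hpatch, ofComplex.norm_map, distL1]
    at hmass himp hdist hEω hEr ⊢
  have h := H A' hA' hA'R (fun ζ z hζ => hsymm.ofComplex_mul (by lia) hζ z) hmass himp
    (hdist.trans hεε₀)
  rw [hEω, hEr]
  simp_rw [abs_sub_comm (annulusC r₁ r₂ _)]
  linarith
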